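/- Let $(\mathbf x,y)$ follow the two-group normal model: $y\sim\mathrm{Ber}(\alpha_1)$ with $0<\alpha_1<1$ and $\mathbf x\mid y\sim\mathcal N_p(y\boldsymbol\mu_1+(1-y)\boldsymbol\mu_2,\boldsymbol\Sigma)$, where $\boldsymbol\mu_1\neq\boldsymbol\mu_2$ are vectors in $\mathbb R^p$ and $\boldsymbol\Sigma$ is a positive definite $p\times p$ covariance matrix. Put $\boldsymbol\theta:=\boldsymbol\Sigma^{-1}(\boldsymbol\mu_2-\boldsymbol\mu_1)$, $\beta:=\alpha_1(1-\alpha_1)$ and $\tau:=(\boldsymbol\mu_2-\boldsymbol\mu_1)'\boldsymbol\Sigma^{-1}(\boldsymbol\mu_2-\boldsymbol\mu_1)$. Let $\mathbf x_1,\mathbf x_2,\dots$ be independent random vectors with the marginal distribution of $\mathbf x$, let $\tilde{\mathbf x}_i:=\mathbf x_i-\frac1n\sum_{j=1}^n\mathbf x_j$, and for $\mathbf u$ in the unit sphere $\mathbb S^{p-1}$ let $$\kappa_n(\mathbf u)=\frac{\frac1n\sum_{i=1}^n(\mathbf u'\tilde{\mathbf x}_i)^4}{\{\frac1n\sum_{i=1}^n(\mathbf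 u'\tilde{\mathbf x}_i)^2\}^2}$$ be the sample kurtosis of the projections. Assume $\alpha_1\notin\{1/2-1/\sqrt{12},\,1/2+1/\sqrt{12}\}$, and let $\mathbf u_n$ be any sequence of random vectors such that, almost surely, for all sufficiently large $n$, $\mathbf u_n$ maximizes $\mathbf u\mapsto\{\kappa_n(\mathbf u)-3\}^2$ over $\mathbb S^{p-1}$. Then there exists a sequence of (random) signs $s_n\in\{-1,1\}$ such that, as $n\to\infty$, 1) $s_n\mathbf u_n\to\boldsymbol\theta/\|\boldsymbol\theta\|$ almost surely; 2) $\sqrt n\,(s_n\mathbf u_n-\boldsymbol\theta/\|\boldsymbol\theta\|)$ converges in distribution to $\mathcal N_p(\mathbf 0,\boldsymbol\Psi_\kappa)$, where the matrix $\boldsymbol\Psi_\kappa$, which is positive semidefinite, is $$\boldsymbol\Psi_\kappa=C_\kappa\,\frac{1+\beta\tau}{\|\boldsymbol\theta\|^2\beta}\Big(\mathbf I_p-\frac{\boldsymbol\theta\boldsymbol\theta'}{\|\boldsymbol\theta\|^2}\Big)\boldsymbol\Sigma^{-1}\Big(\mathbf I_p-\frac{\boldsymbol\theta\boldsymbol\theta'}{\|\boldsymbol\theta\|^2}\Big),\qquad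 C_\kappa=\frac{6+24\beta\tau+9\beta(1-2\beta)\tau^2+\beta(1-3\beta)\tau^3}{\beta\tau^3(1-6\beta)^2}.$$ -/

import Mathlib

open MeasureTheory ProbabilityTheory Filter Topology Matrix

namespace LinDisc

noncomputable section

/-- Law of the class label: `true` (that is, `y = 1`) with probability `α` and `false`
(that is, `y = 0`) with probability `1 - α`. -/
def labelLaw (α : unitInterval) : Measure Bool :=
  bernoulliMeasure true false α

/-- Conditional law of the observation given the label:
`N_p(μ₁, S)` if `y = 1` and `N_p(μ₂, S)` if `y = 0`. -/
def classKernel {p : ℕ} (μ₁ μ₂ : EuclideanSpace ℝ (Fin p)) (S : Matrix (Fin p) (Fin p) ℝ) :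
    Kernel Bool (EuclideanSpace ℝ (Fin p)) :=
  Kernel.ofFunOfCountable fun y => multivariateGaussian (bif y then μ₁ else μ₂) S

/-- Joint law of the pair `(y, x)` in the two-group normal model. -/
def jointLaw {p : ℕ} (α : unitInterval) (μ₁ μ₂ : EuclideanSpace ℝ (Fin p))
    (S : Matrix (Fin p) (Fin p) ℝ) : Measure (Bool × EuclideanSpace ℝ (Fin p)) :=
  (labelLaw α).compProd (classKernel μ₁ μ₂ S)

/-- Marginal law of the observation `x` in the two-group normal model. -/
def mixtureLaw {p : ℕ} (α : unitInterval) (μ₁ μ₂ : EuclideanSpace ℝ (Fin p))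
    (S : Matrix (Fin p) (Fin p) ℝ) : Measure (EuclideanSpace ℝ (Fin p)) :=
  (jointLaw α μ₁ μ₂ S).map Prod.snd

/-- The marginal law of `x` is the normal mixture `α N_p(μ₁, S) + (1 - α) N_p(μ₂, S)`. -/
theorem mixtureLaw_eq {p : ℕ} (α : unitInterval) (μ₁ μ₂ : EuclideanSpace ℝ (Fin p))
    (S : Matrix (Fin p) (Fin p) ℝ) :
    mixtureLaw α μ₁ μ₂ S =
      ENNReal.ofReal (α : ℝ) • multivariateGaussian μ₁ S +
        ENNReal.ofReal (1 - (α : ℝ)) • multivariateGaussian μ₂ S := by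
  have : IsMarkovKernel (classKernel μ₁ μ₂ S) :=
    ⟨fun y => inferInstanceAs
      (IsProbabilityMeasure (multivariateGaussian (bif y then μ₁ else μ₂) S))⟩
  have : IsFiniteMeasure (labelLaw α) := by
    unfold labelLaw
    infer_instance
  ext s hs
  rw [mixtureLaw, jointLaw, Measure.map_apply measurable_snd hs,
    Measure.compProd_apply (measurable_snd hs)]
  have h1 : ENNReal.ofReal (α : ℝ) = (unitInterval.toNNReal α : ENNReal) := by
    rw [← unitInterval.coe_toNNReal, ENNReal.ofReal_coe_nnreal]
  have h2 : ENNReal.ofReal (1 - (α : ℝ)) =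
      (unitInterval.toNNReal (unitInterval.symm α) : ENNReal) := by
    rw [← unitInterval.coe_symm_eq, ← unitInterval.coe_toNNReal, ENNReal.ofReal_coe_nnreal]
  rw [h1, h2]
  simp only [labelLaw, bernoulliMeasure_def, lintegral_add_measure, lintegral_smul_measure,
    lintegral_dirac, ← Set.preimage_comp]
  rfl

/-- The linear discriminant `θ = S⁻¹ (μ₂ - μ₁)`. -/
def discriminant {p : ℕ} (μ₁ μ₂ : EuclideanSpace ℝ (Fin p)) (S : Matrix (Fin p) (Fin p) ℝ) :
    EuclideanSpace ℝ (Fin p) :=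
  WithLp.toLp 2 (S⁻¹ *ᵥ (μ₂ - μ₁).ofLp)

/-- The standardized linear discriminant `θ / ‖θ‖`. -/
def unitDiscriminant {p : ℕ} (μ₁ μ₂ : EuclideanSpace ℝ (Fin p)) (S : Matrix (Fin p) (Fin p) ℝ) :
    EuclideanSpace ℝ (Fin p) :=
  ‖discriminant μ₁ μ₂ S‖⁻¹ • discriminant μ₁ μ₂ S

/-- The squared Mahalanobis distance `τ = (μ₂ - μ₁)' S⁻¹ (μ₂ - μ₁)`. -/
def mahalanobisSq {p : ℕ} (μ₁ μ₂ : EuclideanSpace ℝ (Fin p)) (S : Matrix (Fin p) (Fin p) ℝ) : ℝ :=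
  (μ₂ - μ₁).ofLp ⬝ᵥ (S⁻¹ *ᵥ (μ₂ - μ₁).ofLp)

/-- The sample mean of `x₀, …, xₙ₋₁`. -/
def sampleMean {p : ℕ} (x : ℕ → EuclideanSpace ℝ (Fin p)) (n : ℕ) : EuclideanSpace ℝ (Fin p) :=
  (n : ℝ)⁻¹ • ∑ i ∈ Finset.range n, x i

/-- The `k`-th central sample moment of the projections `u'x₀, …, u'xₙ₋₁`. -/
def sampleMoment {p : ℕ} (x : ℕ → EuclideanSpace ℝ (Fin p)) (n k : ℕ)
    (u : EuclideanSpace ℝ (Fin p)) : ℝ :=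
  (n : ℝ)⁻¹ * ∑ i ∈ Finset.range n, (inner ℝ u (x i - sampleMean x n)) ^ k

/-- The sample kurtosis `κ_n(u)` of the projections `u'x₀, …, u'xₙ₋₁`. -/
def sampleKurtosis {p : ℕ} (x : ℕ → EuclideanSpace ℝ (Fin p)) (n : ℕ)
    (u : EuclideanSpace ℝ (Fin p)) : ℝ :=
  sampleMoment x n 4 u / (sampleMoment x n 2 u) ^ 2

/-- `u` maximizes the squared sample excess kurtosis `(κ_n - 3)²` over the unit sphere. -/
def IsKurtosisMaximizer {p : ℕ} (x : ℕ → EuclideanSpace ℝ (Fin p)) (n : ℕ)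
    (u : EuclideanSpace ℝ (Fin p)) : Prop :=
  u ∈ Metric.sphere (0 : EuclideanSpace ℝ (Fin p)) 1 ∧
    IsMaxOn (fun v => (sampleKurtosis x n v - 3) ^ 2)
      (Metric.sphere (0 : EuclideanSpace ℝ (Fin p)) 1) u

/-- The matrix `I_p - θ θ' / ‖θ‖²`. -/
def orthProj {p : ℕ} (θ : EuclideanSpace ℝ (Fin p)) : Matrix (Fin p) (Fin p) ℝ :=
  1 - (‖θ‖ ^ 2)⁻¹ • vecMulVec θ.ofLp θ.ofLp

/-- The covariance matrix
`Ψ_U = (1 + β τ) / (‖θ‖² β) (I - θθ'/‖θ‖²) S⁻¹ (I - θθ'/‖θ‖²)`, where `β = α (1 - α)`. -/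
def covU {p : ℕ} (α : ℝ) (μ₁ μ₂ : EuclideanSpace ℝ (Fin p)) (S : Matrix (Fin p) (Fin p) ℝ) :
    Matrix (Fin p) (Fin p) ℝ :=
  ((1 + α * (1 - α) * mahalanobisSq μ₁ μ₂ S) /
      (‖discriminant μ₁ μ₂ S‖ ^ 2 * (α * (1 - α)))) •
    (orthProj (discriminant μ₁ μ₂ S) * S⁻¹ * orthProj (discriminant μ₁ μ₂ S))

/-- The factor `C_κ` as a function of `β` and `τ`. -/
def kurtosisFactor (β τ : ℝ) : ℝ :=
  (6 + 24 * β * τ + 9 * β * (1 - 2 * β) * τ ^ 2 + β * (1 - 3 * β) * τ ^ 3) /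
    (β * τ ^ 3 * (1 - 6 * β) ^ 2)

/-- The covariance matrix `Ψ_κ = C_κ Ψ_U`. -/
def covKurtosis {p : ℕ} (α : ℝ) (μ₁ μ₂ : EuclideanSpace ℝ (Fin p))
    (S : Matrix (Fin p) (Fin p) ℝ) : Matrix (Fin p) (Fin p) ℝ :=
  kurtosisFactor (α * (1 - α)) (mahalanobisSq μ₁ μ₂ S) • covU α μ₁ μ₂ S

end

end LinDisc

open LinDisc

open Asymptotics
open scoped RealInnerProductSpace NNReal

/-! A normal mixture is an independent sum of a normal vector and a two-point shift, so its excess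
fourth cumulant in direction `v` comes from the label alone. With `δ = μ₂ - μ₁`, `T` the operator of
`S` and `c = β (1 - 6β)`, the squared excess kurtosis is `c² (⟪δ, v⟫² / M₂ v)⁴`, where `M₂ v = ⟪T v,
v⟫ + β ⟪δ, v⟫²`. As `δ = T θ`, Cauchy–Schwarz for the form of `T` shows that exactly the multiples
of `θ` maximize it (`eq_normalize_of_le_excessSq`). The sample index is the same function of the
empirical moment tensors, which converge by the strong law. Compactness of the sphere then gives
consistency once the sign is chosen by a half space.

For the rate, the index has degree zero, so the rescaled maximizer `θ + r` with `⟪δ, r⟫ = 0` is an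
unconstrained critical point and the score vanishes there. The score is jointly C¹ in moments and
direction, and its derivative at the population point is `-4cτ⁴ T` on the hyperplane orthogonal to
`δ`. Hence `4cτ⁴ T r` equals the sample score at `θ` up to a relatively small error, almost surely
and with no probability involved (`isLittleO_score_zero`, `isLittleO_maximizer_sub`).

The projected limit therefore depends on the score at `θ` only in directions `q` with `⟪δ, q⟫ = 0`.
There `θ'Sq = 0`, so `q'x` is normal with the same law in both groups and independent of `θ'x`. The
leading term is then a normalized iid sum with mean zero, whose variance is a polynomial in moments
up to order six (`tendstoInDistribution_leading_term`). Almost sure little-o errors become errors in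
probability through an envelope bounded in `L¹` (`tendstoInMeasure_of_ae_isLittleO`). Slutsky and
Cramér–Wold finish. -/

namespace LinDisc

/-! ### Critical points and maximizers of the squared excess kurtosis. -/

section Deterministic

variable {A E : Type*} [NormedAddCommGroup A] [NormedSpace ℝ A]
  [NormedAddCommGroup E] [InnerProductSpace ℝ E]

/-- The squared excess kurtosis built from a second and a fourth moment function. -/
noncomputable def excessSq (M₂ M₄ : E → ℝ) (v : E) : ℝ := (M₄ v / M₂ v ^ 2 - 3) ^ 2

/-- The numerator of the differential of `M₄ / M₂ ^ 2`, up to the factor `M₂`. -/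
noncomputable def kurtosisScore (M₂ M₄ : E → ℝ) (v : E) : E →L[ℝ] ℝ :=
  M₂ v • fderiv ℝ M₄ v - (2 * M₄ v) • fderiv ℝ M₂ v

/-- The differential of `(κ - 3)²` is `2 (κ - 3) dκ`, and `dκ` is the score divided by `M₂³`. Away
from `κ = 3` criticality of the square forces the score to vanish. -/
theorem kurtosisScore_eq_zero {M₂ M₄ : E → ℝ} {v : E} (h₂ : DifferentiableAt ℝ M₂ v)
    (h₄ : DifferentiableAt ℝ M₄ v) (hne : M₂ v ≠ 0) (h3 : M₄ v / M₂ v ^ 2 ≠ 3)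
    (hmax : IsLocalMax (excessSq M₂ M₄) v) : kurtosisScore M₂ M₄ v = 0 := by
  have hd : HasFDerivAt (fun w => M₄ w * (M₂ w ^ 2)⁻¹)
      (M₄ v • (-((M₂ v ^ 2) ^ 2)⁻¹ • ((2 * M₂ v) • fderiv ℝ M₂ v)) +
        (M₂ v ^ 2)⁻¹ • fderiv ℝ M₄ v) v := by
    have h1 : HasFDerivAt (fun w => M₂ w ^ 2) ((2 * M₂ v) • fderiv ℝ M₂ v) v := by
      simpa using h₂.hasFDerivAt.pow 2
    have h2 := (hasDerivAt_inv (pow_ne_zero 2 hne)).comp_hasFDerivAt v h1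
    exact h₄.hasFDerivAt.mul h2
  have hd2 := (hd.sub_const 3).pow 2
  have heq : excessSq M₂ M₄ = fun w => (M₄ w * (M₂ w ^ 2)⁻¹ - 3) ^ 2 := by
    funext w
    rw [excessSq, div_eq_mul_inv]
  rw [heq] at hmax
  have h0 := hmax.hasFDerivAt_eq_zero hd2
  ext q
  have h0q := congrArg (fun L : E →L[ℝ] ℝ => L q) h0
  have h3' : M₄ v * (M₂ v ^ 2)⁻¹ - 3 ≠ 0 := by
    rw [← div_eq_mul_inv]; exact sub_ne_zero.2 h3
  simp only [_root_.smul_apply, _root_.add_apply, smul_eq_mul,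
    _root_.zero_apply, nsmul_eq_mul] at h0q
  simp only [kurtosisScore, _root_.sub_apply, _root_.smul_apply,
    smul_eq_mul, _root_.zero_apply]
  have h1 : M₄ v * (-((M₂ v ^ 2) ^ 2)⁻¹ * (2 * M₂ v * (fderiv ℝ M₂ v) q)) +
      (M₂ v ^ 2)⁻¹ * (fderiv ℝ M₄ v) q = 0 := by
    rcases mul_eq_zero.1 h0q with h | h
    · exfalso
      simp at h
      exact h3' h
    · exact h
  field_simp at h1
  linarith

theorem excessSq_smul {M₂ M₄ : E → ℝ} (h₂ : ∀ (l : ℝ) v, M₂ (l • v) = l ^ 2 * M₂ v)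
    (h₄ : ∀ (l : ℝ) v, M₄ (l • v) = l ^ 4 * M₄ v) {l : ℝ} (hl : l ≠ 0) (v : E) :
    excessSq M₂ M₄ (l • v) = excessSq M₂ M₄ v := by
  unfold excessSq
  rw [h₂, h₄, mul_pow, ← pow_mul, mul_div_mul_left _ _ (pow_ne_zero _ hl)]

/-- Degree-zero homogeneity turns the constrained maximum into an unconstrained one at every nonzero
multiple, so no Lagrange multiplier is needed. -/
theorem isLocalMax_excessSq {M₂ M₄ : E → ℝ} (h₂ : ∀ (l : ℝ) v, M₂ (l • v) = l ^ 2 * M₂ v)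
    (h₄ : ∀ (l : ℝ) v, M₄ (l • v) = l ^ 4 * M₄ v) {w : E} (hw : w ∈ Metric.sphere (0 : E) 1)
    (hmax : IsMaxOn (excessSq M₂ M₄) (Metric.sphere (0 : E) 1) w) {l : ℝ} (hl : l ≠ 0) :
    IsLocalMax (excessSq M₂ M₄) (l • w) := by
  have hw0 : w ≠ 0 := fun h => by simp [h] at hw
  have : ∀ᶠ v in 𝓝 (l • w), v ≠ 0 :=
    isOpen_ne.mem_nhds (smul_ne_zero hl hw0)
  filter_upwards [this] with v hv
  have hv' : ‖v‖ ≠ 0 := norm_ne_zero_iff.2 hv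
  rw [excessSq_smul h₂ h₄ hl, ← excessSq_smul h₂ h₄ (inv_ne_zero hv') v]
  refine hmax ?_
  simp [norm_smul, hv']

/-- Uniqueness of the maximizer of the population index on the half sphere. -/
theorem eq_normalize_of_le_excessSq {T : E →L[ℝ] E} (hsymm : ∀ v w, ⟪T v, w⟫ = ⟪v, T w⟫)
    (hpos : ∀ v, v ≠ 0 → 0 < ⟪T v, v⟫) {θ : E} (hθ : θ ≠ 0) {β c : ℝ} (hβ : 0 ≤ β) (hc : c ≠ 0)
    {M₂ M₄ : E → ℝ} (hM₂ : ∀ v, M₂ v = ⟪T v, v⟫ + β * ⟪v, T θ⟫ ^ 2)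
    (hM₄ : ∀ v, M₄ v = 3 * M₂ v ^ 2 + c * ⟪v, T θ⟫ ^ 4) {v : E} (hv : ‖v‖ = 1)
    (hvθ : 0 ≤ ⟪v, θ⟫)
    (hle : excessSq M₂ M₄ (‖θ‖⁻¹ • θ) ≤ excessSq M₂ M₄ v) : v = ‖θ‖⁻¹ • θ := by
  have hv0 : v ≠ 0 := fun h => by simp [h] at hv
  have hθn : 0 < ‖θ‖ := norm_pos_iff.2 hθ
  set τ := ⟪T θ, θ⟫ with hτ
  have hτ0 : 0 < τ := hpos θ hθ
  have hex : ∀ w, w ≠ 0 → excessSq M₂ M₄ w = c ^ 2 * (⟪w, T θ⟫ ^ 2 / M₂ w) ^ 4 := by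
    intro w hw
    have hp := hpos w hw
    have : 0 < M₂ w := by rw [hM₂]; positivity
    rw [excessSq, hM₄]
    field_simp
    ring
  -- Equality case of Cauchy–Schwarz: this is the `T`-energy of the residual after `T`-orthogonal
  -- projection onto `θ`.
  have hid : ∀ w, ⟪T (w - (⟪w, T θ⟫ / τ) • θ), w - (⟪w, T θ⟫ / τ) • θ⟫ =
      ⟪T w, w⟫ - ⟪w, T θ⟫ ^ 2 / τ := by
    intro w
    have h1 : ⟪T θ, w⟫ = ⟪w, T θ⟫ := real_inner_comm _ _
    have h2 : ⟪T w, θ⟫ = ⟪w, T θ⟫ := hsymm _ _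
    simp only [map_sub, map_smul, inner_sub_left, inner_sub_right, real_inner_smul_left,
      real_inner_smul_right, h1, h2, ← hτ]
    field_simp
    ring
  rw [excessSq_smul (by intro l w; simp [hM₂, real_inner_smul_left, real_inner_smul_right]; ring)
    (by intro l w; simp [hM₄, hM₂, real_inner_smul_left, real_inner_smul_right]; ring)
    (inv_ne_zero hθn.ne'), hex θ hθ, hex v hv0] at hle
  have hp := hpos v hv0
  have hm : 0 < M₂ v := by rw [hM₂]; positivity
  have hmθ : 0 < M₂ θ := by rw [hM₂]; positivity
  have hθT : ⟪θ, T θ⟫ = τ := (hsymm θ θ).symm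
  have hle2 : ⟪θ, T θ⟫ ^ 2 / M₂ θ ≤ ⟪v, T θ⟫ ^ 2 / M₂ v := by
    have := le_of_mul_le_mul_left hle (by positivity)
    exact le_of_pow_le_pow_left₀ (by norm_num) (by positivity) this
  rw [div_le_div_iff₀ hmθ hm, hM₂, hM₂ θ, hθT, ← hτ] at hle2
  -- After cross-multiplication the `β` terms agree on both sides and cancel, so the mixture
  -- variance plays no role in locating the maximizer.
  have hle3 : ⟪T v, v⟫ - ⟪v, T θ⟫ ^ 2 / τ ≤ 0 := by
    have : τ ^ 2 * (⟪T v, v⟫ - ⟪v, T θ⟫ ^ 2 / τ) ≤ 0 := by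
      have : τ ^ 2 * (⟪T v, v⟫ - ⟪v, T θ⟫ ^ 2 / τ) = τ ^ 2 * ⟪T v, v⟫ - τ * ⟪v, T θ⟫ ^ 2 := by
        field_simp
      rw [this]
      nlinarith
    by_contra hcon
    push Not at hcon
    have : 0 < τ ^ 2 * (⟪T v, v⟫ - ⟪v, T θ⟫ ^ 2 / τ) := by positivity
    linarith
  have hz : v - (⟪v, T θ⟫ / τ) • θ = 0 := by
    by_contra hcon
    have := hpos _ hcon
    rw [hid] at this
    linarith
  set l := ⟪v, T θ⟫ / τ with hl
  have hvl : v = l • θ := sub_eq_zero.1 hz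
  have hl0 : 0 ≤ l := by
    rw [hvl, real_inner_smul_left, real_inner_self_eq_norm_sq] at hvθ
    by_contra hcon
    push Not at hcon
    have : l * ‖θ‖ ^ 2 < 0 := mul_neg_of_neg_of_pos hcon (by positivity)
    linarith
  have : l * ‖θ‖ = 1 := by
    rw [hvl, norm_smul, Real.norm_of_nonneg hl0] at hv
    exact hv
  rw [hvl, eq_inv_of_mul_eq_one_left this]

end Deterministic

/-! ### Convergence of maximizers by compactness. -/

section Consistency

variable {A E : Type*} [TopologicalSpace A] [NormedAddCommGroup E]

/-- Joint continuity at `a₀` lets the inequality "`w n` beats `u₀`" pass to any cluster point, which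
uniqueness identifies with `u₀`. The closed set `H` excludes the antipodal maximizer. -/
theorem tendsto_of_isMaxOn_excessSq [ProperSpace E] {M₂ M₄ : A → E → ℝ}
    (hc₂ : Continuous (Function.uncurry M₂)) (hc₄ : Continuous (Function.uncurry M₄))
    {a₀ : A} (hpos : ∀ v, v ≠ 0 → M₂ a₀ v ≠ 0) {u₀ : E} (hu₀ : ‖u₀‖ = 1) {H : Set E}
    (hHc : IsClosed H)
    (huniq : ∀ v ∈ H, ‖v‖ = 1 →
      excessSq (M₂ a₀) (M₄ a₀) u₀ ≤ excessSq (M₂ a₀) (M₄ a₀) v → v = u₀)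
    {a : ℕ → A} (ha : Tendsto a atTop (𝓝 a₀)) {w : ℕ → E} (hwH : ∀ n, w n ∈ H)
    (hw : ∀ᶠ n in atTop, w n ∈ Metric.sphere (0 : E) 1 ∧
      IsMaxOn (excessSq (M₂ (a n)) (M₄ (a n))) (Metric.sphere (0 : E) 1) (w n)) :
    Tendsto w atTop (𝓝 u₀) := by
  have hcont : ∀ v, v ≠ 0 →
      ContinuousAt (fun x : A × E => excessSq (M₂ x.1) (M₄ x.1) x.2) (a₀, v) := by
    intro v hv
    have h2 : ContinuousAt (fun x : A × E => M₂ x.1 x.2) (a₀, v) := hc₂.continuousAt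
    have h4 : ContinuousAt (fun x : A × E => M₄ x.1 x.2) (a₀, v) := hc₄.continuousAt
    unfold excessSq
    exact ((h4.div (h2.pow 2) (pow_ne_zero 2 (hpos v hv))).sub continuousAt_const).pow 2
  have hne : ∀ v : E, ‖v‖ = 1 → v ≠ 0 := fun v hv h => by simp [h] at hv
  refine (isCompact_sphere (0 : E) 1).tendsto_nhds_of_unique_mapClusterPt
    (hw.mono fun n h => h.1) fun v hv hcl => ?_
  have hv1 : ‖v‖ = 1 := by simpa using hv
  obtain ⟨U, hU, hUv⟩ := mapClusterPt_iff_ultrafilter.1 hcl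
  refine huniq v (hHc.mem_of_tendsto hUv (Eventually.of_forall hwH)) hv1 ?_
  have ha' : Tendsto a U (𝓝 a₀) := ha.mono_left hU
  have hwv : Tendsto w U (𝓝 v) := hUv
  have h1 : Tendsto (fun n => excessSq (M₂ (a n)) (M₄ (a n)) u₀) U
      (𝓝 (excessSq (M₂ a₀) (M₄ a₀) u₀)) :=
    Tendsto.comp (f := fun n => (a n, u₀)) (hcont u₀ (hne u₀ hu₀)).tendsto
      (ha'.prodMk_nhds tendsto_const_nhds)
  have h2 : Tendsto (fun n => excessSq (M₂ (a n)) (M₄ (a n)) (w n)) U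
      (𝓝 (excessSq (M₂ a₀) (M₄ a₀) v)) :=
    Tendsto.comp (f := fun n => (a n, w n)) (hcont v (hne v hv1)).tendsto
      (ha'.prodMk_nhds hwv)
  exact le_of_tendsto_of_tendsto h1 h2 ((hw.filter_mono hU).mono fun n h =>
    h.2 (by simpa using hu₀))

end Consistency

/-! ### Derivatives of the score and of normalization. -/

section Deterministic

open scoped ContDiff

variable {A E : Type*} [NormedAddCommGroup A] [NormedSpace ℝ A]
  [NormedAddCommGroup E] [InnerProductSpace ℝ E]

theorem contDiff_kurtosisScore {M₂ M₄ : A → E → ℝ}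
    (h₂ : ContDiff ℝ ∞ (Function.uncurry M₂)) (h₄ : ContDiff ℝ ∞ (Function.uncurry M₄)) :
    ContDiff ℝ 1 (fun x : A × E => kurtosisScore (M₂ x.1) (M₄ x.1) x.2) := by
  have key : ∀ {M : A → E → ℝ}, ContDiff ℝ ∞ (Function.uncurry M) →
      ContDiff ℝ 1 (fun x : A × E => fderiv ℝ (M x.1) x.2) := by
    intro M hM
    have hM' : ContDiff ℝ ∞ (Function.uncurry fun (x : A × E) (y : E) => M x.1 y) :=
      hM.comp ((contDiff_fst.comp contDiff_fst).prodMk contDiff_snd)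
    exact hM'.fderiv contDiff_snd (by norm_cast)
  have h1 : ContDiff ℝ 1 (Function.uncurry M₂) := h₂.of_le (by norm_cast)
  have h1' : ContDiff ℝ 1 (Function.uncurry M₄) := h₄.of_le (by norm_cast)
  have h3 : ContDiff ℝ 1 (fun x : A × E => M₂ x.1 x.2) := h1
  have h3' : ContDiff ℝ 1 (fun x : A × E => 2 * M₄ x.1 x.2) := contDiff_const.mul h1'
  exact (h3.smul (key h₄)).sub (h3'.smul (key h₂))

/-- The score at the population moments. -/
theorem kurtosisScore_population {T : E →L[ℝ] E} (hsymm : ∀ v w, ⟪T v, w⟫ = ⟪v, T w⟫)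
    {δ : E} {β c : ℝ} {M₂ M₄ : E → ℝ} (hM₂ : ∀ v, M₂ v = ⟪T v, v⟫ + β * ⟪δ, v⟫ ^ 2)
    (hM₄ : ∀ v, M₄ v = 3 * M₂ v ^ 2 + c * ⟪δ, v⟫ ^ 4) (v : E) :
    kurtosisScore M₂ M₄ v =
      (4 * c * ⟪δ, v⟫ ^ 3) • (⟪T v, v⟫ • innerSL ℝ δ - ⟪δ, v⟫ • innerSL ℝ (T v)) := by
  have hd : HasFDerivAt (fun w => ⟪δ, w⟫) (innerSL ℝ δ) v := (innerSL ℝ δ).hasFDerivAt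
  have hq : HasFDerivAt (fun w => ⟪T w, w⟫) ((2 : ℝ) • innerSL ℝ (T v)) v := by
    have := (T.hasFDerivAt (x := v)).inner ℝ (hasFDerivAt_id v)
    refine this.congr_fderiv ?_
    ext q
    simp [hsymm, two_mul]
    rw [← hsymm, real_inner_comm]
  have h2 : HasFDerivAt M₂ ((2 : ℝ) • innerSL ℝ (T v) + (2 * β * ⟪δ, v⟫) • innerSL ℝ δ) v := by
    rw [funext hM₂]
    refine (hq.add ((hd.pow 2).const_mul β)).congr_fderiv ?_
    ext q
    simp
    ring
  have h4 : HasFDerivAt M₄ ((6 * M₂ v) • ((2 : ℝ) • innerSL ℝ (T v) +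
      (2 * β * ⟪δ, v⟫) • innerSL ℝ δ) + (4 * c * ⟪δ, v⟫ ^ 3) • innerSL ℝ δ) v := by
    rw [funext hM₄]
    refine (((h2.pow 2).const_mul 3).add ((hd.pow 4).const_mul c)).congr_fderiv ?_
    ext q
    simp
    ring
  -- The Gaussian part `3 M₂²` of `M₄` contributes nothing to the score, and the remaining `β` terms
  -- cancel too.
  rw [kurtosisScore, h2.fderiv, h4.fderiv]
  ext q
  simp [hM₄, hM₂]
  ring

/-- With `δ = T θ` the bracket in `kurtosisScore_population` vanishes at `θ`, so its scalar
prefactor need not be differentiated. On the hyperplane orthogonal to `T θ` only a multiple of `T`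
remains, which is what makes the score invertible there. -/
theorem hasFDerivAt_kurtosisScore_population {T : E →L[ℝ] E}
    (hsymm : ∀ v w, ⟪T v, w⟫ = ⟪v, T w⟫)
    {θ : E} {β c : ℝ} {M₂ M₄ : E → ℝ} (hM₂ : ∀ v, M₂ v = ⟪T v, v⟫ + β * ⟪T θ, v⟫ ^ 2)
    (hM₄ : ∀ v, M₄ v = 3 * M₂ v ^ 2 + c * ⟪T θ, v⟫ ^ 4) :
    HasFDerivAt (kurtosisScore M₂ M₄)
      ((4 * c * ⟪T θ, θ⟫ ^ 3) • ((innerSL ℝ (T θ)).smulRight (innerSL ℝ (T θ)) -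
        ⟪T θ, θ⟫ • ((innerSL ℝ : E →L[ℝ] E →L[ℝ] ℝ).comp T : E →L[ℝ] E →L[ℝ] ℝ))) θ := by
  rw [funext (kurtosisScore_population hsymm hM₂ hM₄)]
  have hd : HasFDerivAt (fun w => ⟪T θ, w⟫) (innerSL ℝ (T θ)) θ := (innerSL ℝ (T θ)).hasFDerivAt
  have hq : HasFDerivAt (fun w => ⟪T w, w⟫) ((2 : ℝ) • innerSL ℝ (T θ)) θ := by
    have := (T.hasFDerivAt (x := θ)).inner ℝ (hasFDerivAt_id θ)
    refine this.congr_fderiv ?_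
    ext q
    simp [hsymm, two_mul]
    rw [← hsymm, real_inner_comm]
  have hT : HasFDerivAt (fun w => innerSL ℝ (T w)) (((innerSL ℝ : E →L[ℝ] E →L[ℝ] ℝ).comp T : E →L[ℝ] E →L[ℝ] ℝ)) θ :=
    (((innerSL ℝ : E →L[ℝ] E →L[ℝ] ℝ).comp T : E →L[ℝ] E →L[ℝ] ℝ)).hasFDerivAt
  have h := ((hd.pow 3).const_mul (4 * c)).smul
    ((hq.smul_const (innerSL ℝ (T θ))).sub (hd.smul hT))
  refine h.congr_fderiv ?_
  ext r q
  simp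
  ring_nf
  simp

/-- Source of the factor `1/‖θ‖` and of the projections on either side of `S⁻¹` in the limiting
covariance. -/
theorem hasFDerivAt_normalize {θ : E} (hθ : θ ≠ 0) :
    HasFDerivAt (fun v : E => ‖v‖⁻¹ • v)
      (‖θ‖⁻¹ • (ContinuousLinearMap.id ℝ E -
        (innerSL ℝ (‖θ‖⁻¹ • θ)).smulRight (‖θ‖⁻¹ • θ))) θ := by
  have hn : ‖θ‖ ≠ 0 := norm_ne_zero_iff.2 hθ
  have h1 : HasFDerivAt (fun v : E => ‖v‖) (‖θ‖⁻¹ • innerSL ℝ θ) θ := by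
    have := ((hasStrictFDerivAt_norm_sq θ).hasFDerivAt).sqrt (by positivity)
    simp only [Real.sqrt_sq (norm_nonneg _)] at this
    refine this.congr_fderiv ?_
    ext q
    simp
    field_simp
  have h2 := ((hasDerivAt_inv hn).comp_hasFDerivAt θ h1).smul (hasFDerivAt_id θ)
  refine h2.congr_fderiv ?_
  ext q
  simp only [Function.comp_apply, id_eq, _root_.add_apply, _root_.smul_apply,
    ContinuousLinearMap.id_apply, ContinuousLinearMap.smulRight_apply, smul_smul, smul_eq_mul,
    innerSL_apply_apply, _root_.sub_apply, smul_sub, real_inner_smul_left]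
  rw [sub_eq_add_neg, ← neg_smul]
  congr 2
  field_simp

end Deterministic

/-! ### Linearization of the maximizers. -/

section Expansion

open scoped ContDiff

variable {A E : Type*} [NormedAddCommGroup A] [NormedSpace ℝ A]
  [NormedAddCommGroup E] [InnerProductSpace ℝ E]

/-- First order expansion of a zero of the score close to the population zero. -/
theorem isLittleO_score_zero {M₂ M₄ : A → E → ℝ}
    (h₂ : ContDiff ℝ ∞ (Function.uncurry M₂)) (h₄ : ContDiff ℝ ∞ (Function.uncurry M₄))
    {T B : E →L[ℝ] E} (hsymm : ∀ v w, ⟪T v, w⟫ = ⟪v, T w⟫) (hBT : ∀ v, B (T v) = v)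
    {θ : E} {β c : ℝ} (hτ : ⟪T θ, θ⟫ ≠ 0) (hc : c ≠ 0) {a₀ : A}
    (hM₂ : ∀ v, M₂ a₀ v = ⟪T v, v⟫ + β * ⟪T θ, v⟫ ^ 2)
    (hM₄ : ∀ v, M₄ a₀ v = 3 * M₂ a₀ v ^ 2 + c * ⟪T θ, v⟫ ^ 4)
    {a : ℕ → A} (ha : Tendsto a atTop (𝓝 a₀)) {r : ℕ → E} (hr : Tendsto r atTop (𝓝 0))
    (hrθ : ∀ᶠ n in atTop, ⟪T θ, r n⟫ = 0)
    (hzero : ∀ᶠ n in atTop, kurtosisScore (M₂ (a n)) (M₄ (a n)) (θ + r n) = 0) :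
    r =O[atTop] (fun n => kurtosisScore (M₂ (a n)) (M₄ (a n)) θ) ∧
    (fun n => (4 * c * ⟪T θ, θ⟫ ^ 4) • innerSL ℝ (T (r n)) -
      kurtosisScore (M₂ (a n)) (M₄ (a n)) θ) =o[atTop]
      (fun n => kurtosisScore (M₂ (a n)) (M₄ (a n)) θ) := by
  set Φ : A × E → (E →L[ℝ] ℝ) := fun x => kurtosisScore (M₂ x.1) (M₄ x.1) x.2 with hΦ
  set k : ℝ := 4 * c * ⟪T θ, θ⟫ ^ 4 with hk
  have hk0 : k ≠ 0 := by positivity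
  -- Strict differentiability is needed because both compared points, `(a n, θ + r n)` and `(a n,
  -- θ)`, move with `n`. Their difference lies in the direction variable, so the derivative in the
  -- moments never has to be computed.
  obtain ⟨L, hL⟩ : ∃ L, HasStrictFDerivAt Φ L (a₀, θ) :=
    ⟨_, (contDiff_kurtosisScore h₂ h₄).contDiffAt.hasStrictFDerivAt (by norm_num)⟩
  have hL2 : ∀ q, ⟪T θ, q⟫ = 0 → L (0, q) = -(k • innerSL ℝ (T q)) := by
    intro q hq
    have h1 := hL.hasFDerivAt.comp θ ((hasFDerivAt_const a₀ θ).prodMk (hasFDerivAt_id θ))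
    have h2 := hasFDerivAt_kurtosisScore_population hsymm hM₂ hM₄
    have h3 := h1.unique h2
    have h4 := congrArg (fun l : E →L[ℝ] (E →L[ℝ] ℝ) => l q) h3
    simp only [ContinuousLinearMap.comp_apply, ContinuousLinearMap.prod_apply,
      _root_.zero_apply, ContinuousLinearMap.id_apply] at h4
    rw [h4]
    ext x
    simp [hq, hk]
    ring
  have hlim : Tendsto (fun n => ((a n, θ + r n), (a n, θ))) atTop (𝓝 ((a₀, θ), (a₀, θ))) := by
    have : Tendsto (fun n => θ + r n) atTop (𝓝 θ) := by simpa using hr.const_add θ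
    exact (ha.prodMk_nhds this).prodMk_nhds (ha.prodMk_nhds tendsto_const_nhds)
  have ho := hL.isLittleO.comp_tendsto hlim
  have ho' : (fun n => k • innerSL ℝ (T (r n)) - Φ (a n, θ)) =o[atTop] r := by
    have h1 : (fun n => ((a n, θ + r n) : A × E) - (a n, θ)) =O[atTop] r := by
      refine IsBigO.of_bound 1 (Eventually.of_forall fun n => ?_)
      simp [Prod.norm_def]
    refine (IsLittleO.trans_isBigO ho h1).congr' ?_ EventuallyEq.rfl
    filter_upwards [hrθ, hzero] with n hn hz
    have : Φ (a n, θ + r n) = 0 := hz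
    have h5 : ((a n, θ + r n) : A × E) - (a n, θ) = (0, r n) := by simp
    simp only [Function.comp_apply]
    rw [this, h5, hL2 _ hn]
    abel
  have hrT : r =O[atTop] (fun n => k • innerSL ℝ (T (r n))) := by
    have h1 : r =O[atTop] (fun n => T (r n)) :=
      (B.isBigO_comp (fun n => T (r n)) atTop).congr_left fun n => hBT _
    refine h1.trans (IsBigO.of_bound |k|⁻¹ (Eventually.of_forall fun n => ?_))
    rw [norm_smul, innerSL_apply_norm, Real.norm_eq_abs, ← mul_assoc,
      inv_mul_cancel₀ (abs_ne_zero.2 hk0), one_mul]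
  have hro : (fun n => k • innerSL ℝ (T (r n)) - Φ (a n, θ)) =o[atTop]
      (fun n => k • innerSL ℝ (T (r n))) := ho'.trans_isBigO hrT
  -- Absorption: the error is small relative to the left side itself, so that side is controlled by
  -- the score.
  have hΦr : (fun n => k • innerSL ℝ (T (r n))) =O[atTop] (fun n => Φ (a n, θ)) := by
    have := hro.symm.right_isBigO_add
    refine this.congr_right fun n => ?_
    abel
  exact ⟨hrT.trans hΦr, hro.trans_isBigO hΦr⟩

/-- Bahadur type representation of the maximizers of the squared excess kurtosis. -/
theorem isLittleO_maximizer_sub [ProperSpace E] {M₂ M₄ : A → E → ℝ}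
    (h₂ : ContDiff ℝ ∞ (Function.uncurry M₂)) (h₄ : ContDiff ℝ ∞ (Function.uncurry M₄))
    (hh₂ : ∀ a (l : ℝ) v, M₂ a (l • v) = l ^ 2 * M₂ a v)
    (hh₄ : ∀ a (l : ℝ) v, M₄ a (l • v) = l ^ 4 * M₄ a v)
    {T B : E →L[ℝ] E} (hsymm : ∀ v w, ⟪T v, w⟫ = ⟪v, T w⟫)
    (hpos : ∀ v, v ≠ 0 → 0 < ⟪T v, v⟫) (hBT : ∀ v, B (T v) = v) (hTB : ∀ v, T (B v) = v)
    {θ : E} (hθ : θ ≠ 0) {β c : ℝ} (hβ : 0 ≤ β) (hc : c ≠ 0) {a₀ : A}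
    (hM₂ : ∀ v, M₂ a₀ v = ⟪T v, v⟫ + β * ⟪T θ, v⟫ ^ 2)
    (hM₄ : ∀ v, M₄ a₀ v = 3 * M₂ a₀ v ^ 2 + c * ⟪T θ, v⟫ ^ 4)
    {a : ℕ → A} (ha : Tendsto a atTop (𝓝 a₀)) {w : ℕ → E} (hwθ : ∀ n, 0 ≤ ⟪w n, θ⟫)
    (hw : ∀ᶠ n in atTop, w n ∈ Metric.sphere (0 : E) 1 ∧
      IsMaxOn (excessSq (M₂ (a n)) (M₄ (a n))) (Metric.sphere (0 : E) 1) (w n)) :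
    Tendsto w atTop (𝓝 (‖θ‖⁻¹ • θ)) ∧ ∀ t : E,
      (fun n => ⟪t, w n - ‖θ‖⁻¹ • θ⟫ - (4 * c * ⟪T θ, θ⟫ ^ 4 * ‖θ‖)⁻¹ *
        kurtosisScore (M₂ (a n)) (M₄ (a n)) θ (B (t - ⟪‖θ‖⁻¹ • θ, t⟫ • (‖θ‖⁻¹ • θ))))
      =o[atTop] (fun n => kurtosisScore (M₂ (a n)) (M₄ (a n)) θ) := by
  have hθn : 0 < ‖θ‖ := norm_pos_iff.2 hθ
  set u₀ := ‖θ‖⁻¹ • θ with hu₀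
  set τ := ⟪T θ, θ⟫ with hτ
  have hτ0 : 0 < τ := hpos θ hθ
  have hu₀1 : ‖u₀‖ = 1 := by simp [hu₀, norm_smul, hθn.ne']
  have hM₂pos : ∀ v, v ≠ 0 → 0 < M₂ a₀ v := by
    intro v hv
    have := hpos v hv
    rw [hM₂]
    positivity
  have hlim : Tendsto w atTop (𝓝 u₀) := by
    refine tendsto_of_isMaxOn_excessSq (H := {v | 0 ≤ ⟪v, θ⟫}) h₂.continuous h₄.continuous
      (fun v hv => (hM₂pos v hv).ne') hu₀1 ?_ ?_ ha hwθ hw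
    · exact isClosed_le continuous_const (continuous_id.inner continuous_const)
    · intro v hv hv1 hle
      exact eq_normalize_of_le_excessSq hsymm hpos hθ hβ hc
        (fun v => by rw [hM₂, real_inner_comm v (T θ)]) (fun v => by rw [hM₄, real_inner_comm v (T θ)])
        hv1 hv hle
  refine ⟨hlim, fun t => ?_⟩
  have hdlim : Tendsto (fun n => ⟪T θ, w n⟫) atTop (𝓝 (‖θ‖⁻¹ * τ)) := by
    have : Tendsto (fun n => ⟪T θ, w n⟫) atTop (𝓝 ⟪T θ, u₀⟫) := tendsto_const_nhds.inner hlim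
    rwa [hu₀, real_inner_smul_right] at this
  have hdpos : ∀ᶠ n in atTop, 0 < ⟪T θ, w n⟫ :=
    hdlim.eventually (lt_mem_nhds (by positivity))
  -- The scale that places `l n • w n - θ` in the hyperplane orthogonal to `T θ`, where the
  -- derivative of the score is known.
  set l : ℕ → ℝ := fun n => τ / ⟪T θ, w n⟫ with hl
  have hllim : Tendsto l atTop (𝓝 ‖θ‖) := by
    have := (tendsto_const_nhds (x := τ)).div hdlim (by positivity)
    have e : τ / (‖θ‖⁻¹ * τ) = ‖θ‖ := by field_simp
    rwa [e] at this
  set r : ℕ → E := fun n => l n • w n - θ with hr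
  have hrlim : Tendsto r atTop (𝓝 0) := by
    have := (hllim.smul hlim).sub_const θ
    rwa [hu₀, smul_inv_smul₀ hθn.ne', sub_self] at this
  have hrθ : ∀ᶠ n in atTop, ⟪T θ, r n⟫ = 0 := by
    filter_upwards [hdpos] with n hn
    simp only [hr, hl, inner_sub_right, real_inner_smul_right, ← hτ]
    field_simp
    ring
  have hcont : ∀ {M : A → E → ℝ}, Continuous (Function.uncurry M) →
      Tendsto (fun n => M (a n) (θ + r n)) atTop (𝓝 (M a₀ θ)) := by
    intro M hM
    have h1 : Tendsto (fun n => θ + r n) atTop (𝓝 θ) := by simpa using hrlim.const_add θ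
    exact Tendsto.comp (f := fun n => (a n, θ + r n)) hM.continuousAt.tendsto
      (ha.prodMk_nhds h1)
  have hzero : ∀ᶠ n in atTop, kurtosisScore (M₂ (a n)) (M₄ (a n)) (θ + r n) = 0 := by
    have e2 : ∀ᶠ n in atTop, 0 < M₂ (a n) (θ + r n) :=
      (hcont h₂.continuous).eventually (lt_mem_nhds (hM₂pos θ hθ))
    -- The limiting excess kurtosis is `c τ⁴ / M₂²`; this is where `c ≠ 0` excludes a spurious
    -- critical point.
    have e3 : ∀ᶠ n in atTop, M₄ (a n) (θ + r n) / M₂ (a n) (θ + r n) ^ 2 ≠ 3 := by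
      have h1 := (hcont h₄.continuous).div ((hcont h₂.continuous).pow 2)
        (pow_ne_zero 2 (hM₂pos θ hθ).ne')
      refine h1.eventually_ne ?_
      have := hM₂pos θ hθ
      rw [hM₄, Ne, div_eq_iff (by positivity), ← sub_eq_zero, ← hτ]
      ring_nf
      positivity
    filter_upwards [e2, e3, hw, hdpos] with n h2n h3n hwn hdn
    have hv : θ + r n = l n • w n := by simp [hr]
    have hd2 : Differentiable ℝ (M₂ (a n)) :=
      (h₂.comp (contDiff_const.prodMk contDiff_id)).differentiable (by simp)
    have hd4 : Differentiable ℝ (M₄ (a n)) :=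
      (h₄.comp (contDiff_const.prodMk contDiff_id)).differentiable (by simp)
    refine kurtosisScore_eq_zero hd2.differentiableAt hd4.differentiableAt h2n.ne' h3n ?_
    rw [hv]
    exact isLocalMax_excessSq (hh₂ _) (hh₄ _) hwn.1 hwn.2 (by positivity)
  obtain ⟨hO, ho⟩ := isLittleO_score_zero h₂ h₄ hsymm hBT hτ0.ne' hc hM₂ hM₄ ha hrlim hrθ hzero
  rw [← hτ] at ho
  set k : ℝ := 4 * c * τ ^ 4 with hk
  have hk0 : k ≠ 0 := by positivity
  set Φ := fun n => kurtosisScore (M₂ (a n)) (M₄ (a n)) θ with hΦ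
  have hN := (hasFDerivAt_normalize hθ).isLittleO
  have hN1 : (fun n => ‖θ + r n‖⁻¹ • (θ + r n) - u₀ - (‖θ‖⁻¹ • (ContinuousLinearMap.id ℝ E -
        (innerSL ℝ u₀).smulRight u₀)) (r n)) =o[atTop] r := by
    have h1 : Tendsto (fun n => θ + r n) atTop (𝓝 θ) := by simpa using hrlim.const_add θ
    refine (hN.comp_tendsto h1).congr (fun n => ?_) (fun n => ?_) <;>
      simp only [Function.comp_apply, add_sub_cancel_left, ← hu₀]
  have hN2 : (fun n => ⟪t, w n - u₀⟫ - ‖θ‖⁻¹ * ⟪t - ⟪u₀, t⟫ • u₀, r n⟫) =o[atTop] r := by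
    have h1 := ((innerSL ℝ t).isBigO_comp _ atTop).trans_isLittleO hN1
    refine h1.congr' ?_ EventuallyEq.rfl
    filter_upwards [hdpos, hw] with n hn hwn
    have hv : θ + r n = l n • w n := by simp [hr]
    have hln : 0 < l n := by positivity
    have hw1 : ‖w n‖ = 1 := by simpa using hwn.1
    have : ‖θ + r n‖⁻¹ • (θ + r n) = w n := by
      rw [hv, norm_smul, hw1, mul_one, Real.norm_of_nonneg hln.le, inv_smul_smul₀ hln.ne']
    rw [this]
    simp [inner_sub_right, inner_sub_left, real_inner_smul_left, real_inner_smul_right]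
    rw [real_inner_comm t u₀]
    ring_nf
    simp
  have hrep : (fun n => ‖θ‖⁻¹ * ⟪t - ⟪u₀, t⟫ • u₀, r n⟫ - (k * ‖θ‖)⁻¹ *
      Φ n (B (t - ⟪u₀, t⟫ • u₀))) =o[atTop] Φ := by
    set q := t - ⟪u₀, t⟫ • u₀
    have h1 : (fun n => (k • innerSL ℝ (T (r n)) - Φ n) (B q)) =o[atTop] Φ :=
      (IsBigO.of_bound ‖B q‖ (Eventually.of_forall fun n => by
        rw [mul_comm]; exact ContinuousLinearMap.le_opNorm _ _)).trans_isLittleO ho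
    refine (h1.const_mul_left ((k * ‖θ‖)⁻¹)).congr_left fun n => ?_
    have h2 : ⟪T (r n), B q⟫ = ⟪q, r n⟫ := by rw [hsymm, hTB, real_inner_comm]
    simp only [_root_.sub_apply, _root_.smul_apply, innerSL_apply_apply, smul_eq_mul, h2]
    field_simp
  refine ((hN2.trans_isBigO hO).add hrep).congr_left fun n => ?_
  ring

end Expansion

/-! ### Sample kurtosis as a smooth function of empirical moment tensors. -/

section Moments

open scoped ContDiff

variable {p : ℕ}

/-- Index set of the coordinates of all tensors of order at most four on `ℝ^p`. -/
abbrev MomentIndex (p : ℕ) : Type := Σ k : Fin 5, (Fin k → Fin p)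

/-- The coordinates of the tensor powers of order at most four of `x`. -/
noncomputable def momentTensor (x : EuclideanSpace ℝ (Fin p)) : MomentIndex p → ℝ :=
  fun I => ∏ j, x (I.2 j)

/-- The raw moment of order `k` in direction `v` read off from the moment tensors `a`. -/
noncomputable def rawMoment (k : Fin 5) (a : MomentIndex p → ℝ)
    (v : EuclideanSpace ℝ (Fin p)) : ℝ :=
  ∑ I : Fin k → Fin p, a ⟨k, I⟩ * ∏ j, v (I j)

/-- The second central moment read off from the moment tensors. -/
noncomputable def centralSecond (a : MomentIndex p → ℝ) (v : EuclideanSpace ℝ (Fin p)) : ℝ :=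
  rawMoment 2 a v - rawMoment 1 a v ^ 2

/-- The fourth central moment read off from the moment tensors. -/
noncomputable def centralFourth (a : MomentIndex p → ℝ) (v : EuclideanSpace ℝ (Fin p)) : ℝ :=
  rawMoment 4 a v - 4 * rawMoment 3 a v * rawMoment 1 a v +
    6 * rawMoment 2 a v * rawMoment 1 a v ^ 2 - 3 * rawMoment 1 a v ^ 4

/-- The moment tensors of order at most four of the sample centered at `m`. -/
noncomputable def sampleTensor (x : ℕ → EuclideanSpace ℝ (Fin p))
    (m : EuclideanSpace ℝ (Fin p)) (n : ℕ) : MomentIndex p → ℝ :=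
  (n : ℝ)⁻¹ • ∑ i ∈ Finset.range n, momentTensor (x i - m)

theorem rawMoment_momentTensor (k : Fin 5) (x v : EuclideanSpace ℝ (Fin p)) :
    rawMoment k (momentTensor x) v = ⟪v, x⟫ ^ (k : ℕ) := by
  have : ⟪v, x⟫ = ∑ i, x i * v i := by
    simp [PiLp.inner_apply]
  rw [this, Fintype.sum_pow, rawMoment]
  refine Finset.sum_congr rfl fun I _ => ?_
  rw [Finset.prod_mul_distrib, momentTensor]

/-- The raw moment as a linear functional of the moment tensors. -/
noncomputable def rawMomentCLM (k : Fin 5) (v : EuclideanSpace ℝ (Fin p)) :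
    (MomentIndex p → ℝ) →L[ℝ] ℝ :=
  ∑ I : Fin k → Fin p, (∏ j, v (I j)) •
    (ContinuousLinearMap.proj ⟨k, I⟩ : (MomentIndex p → ℝ) →L[ℝ] ℝ)

theorem rawMomentCLM_apply (k : Fin 5) (v : EuclideanSpace ℝ (Fin p)) (a : MomentIndex p → ℝ) :
    rawMomentCLM k v a = rawMoment k a v := by
  simp [rawMomentCLM, rawMoment, mul_comm]

theorem contDiff_rawMoment (k : Fin 5) :
    ContDiff ℝ ∞ (Function.uncurry (rawMoment (p := p) k)) := by
  unfold rawMoment Function.uncurry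
  refine ContDiff.sum fun I _ => ?_
  refine ContDiff.mul ?_ (contDiff_prod fun j _ => ?_)
  · exact (contDiff_apply ℝ ℝ (⟨k, I⟩ : MomentIndex p)).comp contDiff_fst
  · exact (EuclideanSpace.proj (I j) : EuclideanSpace ℝ (Fin p) →L[ℝ] ℝ).contDiff.comp contDiff_snd

theorem contDiff_centralSecond :
    ContDiff ℝ ∞ (Function.uncurry (centralSecond (p := p))) := by
  unfold centralSecond
  exact (contDiff_rawMoment 2).sub ((contDiff_rawMoment 1).pow 2)

theorem contDiff_centralFourth :
    ContDiff ℝ ∞ (Function.uncurry (centralFourth (p := p))) := by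
  unfold centralFourth
  have h1 := contDiff_rawMoment (p := p) 1
  have h2 := contDiff_rawMoment (p := p) 2
  have h3 := contDiff_rawMoment (p := p) 3
  have h4 := contDiff_rawMoment (p := p) 4
  exact ((h4.sub ((contDiff_const.mul h3).mul h1)).add
    ((contDiff_const.mul h2).mul (h1.pow 2))).sub (contDiff_const.mul (h1.pow 4))

theorem rawMoment_smul (k : Fin 5) (a : MomentIndex p → ℝ) (l : ℝ)
    (v : EuclideanSpace ℝ (Fin p)) :
    rawMoment k a (l • v) = l ^ (k : ℕ) * rawMoment k a v := by
  simp only [rawMoment, Finset.mul_sum, PiLp.smul_apply, smul_eq_mul, Finset.prod_mul_distrib,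
    Finset.prod_const, Finset.card_univ, Fintype.card_fin]
  exact Finset.sum_congr rfl fun I _ => by ring

theorem centralSecond_smul (a : MomentIndex p → ℝ) (l : ℝ) (v : EuclideanSpace ℝ (Fin p)) :
    centralSecond a (l • v) = l ^ 2 * centralSecond a v := by
  simp only [centralSecond, rawMoment_smul]
  simp
  ring

theorem centralFourth_smul (a : MomentIndex p → ℝ) (l : ℝ) (v : EuclideanSpace ℝ (Fin p)) :
    centralFourth a (l • v) = l ^ 4 * centralFourth a v := by
  simp only [centralFourth, rawMoment_smul]
  simp
  ring

theorem rawMoment_sampleTensor (k : Fin 5) (x : ℕ → EuclideanSpace ℝ (Fin p))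
    (m v : EuclideanSpace ℝ (Fin p)) (n : ℕ) :
    rawMoment k (sampleTensor x m n) v =
      (n : ℝ)⁻¹ * ∑ i ∈ Finset.range n, ⟪v, x i - m⟫ ^ (k : ℕ) := by
  rw [← rawMomentCLM_apply, sampleTensor, map_smul, map_sum]
  simp only [rawMomentCLM_apply, rawMoment_momentTensor, smul_eq_mul]

/-- Central sample moments do not depend on the reference point `m`. Taking the population mean
later makes the first raw moment tend to zero. -/
theorem inner_sub_sampleMean (x : ℕ → EuclideanSpace ℝ (Fin p))
    (m v : EuclideanSpace ℝ (Fin p)) {n : ℕ} (hn : n ≠ 0) (i : ℕ) :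
    ⟪v, x i - sampleMean x n⟫ =
      ⟪v, x i - m⟫ - (n : ℝ)⁻¹ * ∑ i ∈ Finset.range n, ⟪v, x i - m⟫ := by
  have hn' : (n : ℝ) ≠ 0 := Nat.cast_ne_zero.2 hn
  simp only [sampleMean, inner_sub_right, Finset.sum_sub_distrib, real_inner_smul_right,
    inner_sum, Finset.sum_const, Finset.card_range, nsmul_eq_mul]
  field_simp
  ring

theorem centralSecond_sampleTensor (x : ℕ → EuclideanSpace ℝ (Fin p))
    (m v : EuclideanSpace ℝ (Fin p)) {n : ℕ} (hn : n ≠ 0) :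
    centralSecond (sampleTensor x m n) v = sampleMoment x n 2 v := by
  have hn' : (n : ℝ) ≠ 0 := Nat.cast_ne_zero.2 hn
  simp only [centralSecond, rawMoment_sampleTensor, sampleMoment, inner_sub_sampleMean x m v hn]
  simp only [Fin.val_two, Fin.val_one, pow_one]
  set r := (n : ℝ)⁻¹ * ∑ i ∈ Finset.range n, ⟪v, x i - m⟫ with hr
  have h1 : ∑ i ∈ Finset.range n, ⟪v, x i - m⟫ = n * r := by rw [hr]; field_simp
  have : ∀ i, (⟪v, x i - m⟫ - r) ^ 2 = ⟪v, x i - m⟫ ^ 2 - 2 * r * ⟪v, x i - m⟫ + r ^ 2 :=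
    fun i => by ring
  simp only [this, Finset.sum_add_distrib, Finset.sum_sub_distrib, ← Finset.mul_sum,
    Finset.sum_const, Finset.card_range, nsmul_eq_mul, h1]
  field_simp
  ring

theorem centralFourth_sampleTensor (x : ℕ → EuclideanSpace ℝ (Fin p))
    (m v : EuclideanSpace ℝ (Fin p)) {n : ℕ} (hn : n ≠ 0) :
    centralFourth (sampleTensor x m n) v = sampleMoment x n 4 v := by
  have hn' : (n : ℝ) ≠ 0 := Nat.cast_ne_zero.2 hn
  simp only [centralFourth, rawMoment_sampleTensor, sampleMoment, inner_sub_sampleMean x m v hn]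
  simp only [Fin.val_two, Fin.val_one, pow_one, show ((3 : Fin 5) : ℕ) = 3 from rfl,
    show ((4 : Fin 5) : ℕ) = 4 from rfl]
  set r := (n : ℝ)⁻¹ * ∑ i ∈ Finset.range n, ⟪v, x i - m⟫ with hr
  have h1 : ∑ i ∈ Finset.range n, ⟪v, x i - m⟫ = n * r := by rw [hr]; field_simp
  have : ∀ i, (⟪v, x i - m⟫ - r) ^ 4 = ⟪v, x i - m⟫ ^ 4 - 4 * r * ⟪v, x i - m⟫ ^ 3 +
      6 * r ^ 2 * ⟪v, x i - m⟫ ^ 2 - 4 * r ^ 3 * ⟪v, x i - m⟫ + r ^ 4 :=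
    fun i => by ring
  simp only [this, Finset.sum_add_distrib, Finset.sum_sub_distrib, ← Finset.mul_sum,
    Finset.sum_const, Finset.card_range, nsmul_eq_mul, h1]
  field_simp
  ring

theorem excessSq_sampleTensor (x : ℕ → EuclideanSpace ℝ (Fin p))
    (m : EuclideanSpace ℝ (Fin p)) {n : ℕ} (hn : n ≠ 0) :
    excessSq (centralSecond (sampleTensor x m n)) (centralFourth (sampleTensor x m n)) =
      fun v => (sampleKurtosis x n v - 3) ^ 2 := by
  funext v
  rw [excessSq, centralSecond_sampleTensor x m v hn, centralFourth_sampleTensor x m v hn,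
    sampleKurtosis]

theorem hasFDerivAt_sampleMoment (x : ℕ → EuclideanSpace ℝ (Fin p)) (n k : ℕ)
    (v : EuclideanSpace ℝ (Fin p)) :
    HasFDerivAt (sampleMoment x n k) ((n : ℝ)⁻¹ • ∑ i ∈ Finset.range n,
      (k * ⟪v, x i - sampleMean x n⟫ ^ (k - 1)) • innerSL ℝ (x i - sampleMean x n)) v := by
  have : ∀ i, HasFDerivAt (fun w => ⟪w, x i - sampleMean x n⟫ ^ k)
      ((k * ⟪v, x i - sampleMean x n⟫ ^ (k - 1)) • innerSL ℝ (x i - sampleMean x n)) v := by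
    intro i
    have h1 : HasFDerivAt (fun w => ⟪w, x i - sampleMean x n⟫)
        (innerSL ℝ (x i - sampleMean x n)) v := by
      simp only [real_inner_comm (x i - sampleMean x n)]
      exact (innerSL ℝ (x i - sampleMean x n)).hasFDerivAt
    simpa using h1.pow k
  exact (HasFDerivAt.fun_sum fun i _ => this i).const_mul _

/-- The score of the sample moments in the direction `q`. -/
theorem kurtosisScore_sampleTensor (x : ℕ → EuclideanSpace ℝ (Fin p))
    (m v q : EuclideanSpace ℝ (Fin p)) {n : ℕ} (hn : n ≠ 0) :
    kurtosisScore (centralSecond (sampleTensor x m n)) (centralFourth (sampleTensor x m n)) v q =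
      4 * (centralSecond (sampleTensor x m n) v * ((n : ℝ)⁻¹ * ∑ i ∈ Finset.range n,
          ⟪v, x i - sampleMean x n⟫ ^ 3 * ⟪q, x i - sampleMean x n⟫) -
        centralFourth (sampleTensor x m n) v * ((n : ℝ)⁻¹ * ∑ i ∈ Finset.range n,
          ⟪v, x i - sampleMean x n⟫ * ⟪q, x i - sampleMean x n⟫)) := by
  have e2 : centralSecond (sampleTensor x m n) = sampleMoment x n 2 :=
    funext fun v => centralSecond_sampleTensor x m v hn
  have e4 : centralFourth (sampleTensor x m n) = sampleMoment x n 4 :=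
    funext fun v => centralFourth_sampleTensor x m v hn
  rw [e2, e4, kurtosisScore, (hasFDerivAt_sampleMoment x n 2 v).fderiv,
    (hasFDerivAt_sampleMoment x n 4 v).fderiv]
  simp only [_root_.sub_apply, _root_.smul_apply, _root_.sum_apply, smul_eq_mul,
    innerSL_apply_apply, real_inner_comm q, mul_assoc, ← Finset.mul_sum]
  norm_num
  ring

/-- Infinitesimal form of degree-zero homogeneity. It allows any test direction to be altered by a
multiple of `θ` when the score at `θ` is bounded. -/
theorem kurtosisScore_sampleTensor_self (x : ℕ → EuclideanSpace ℝ (Fin p))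
    (m v : EuclideanSpace ℝ (Fin p)) {n : ℕ} (hn : n ≠ 0) :
    kurtosisScore (centralSecond (sampleTensor x m n)) (centralFourth (sampleTensor x m n)) v v =
      0 := by
  rw [kurtosisScore_sampleTensor x m v v hn, centralSecond_sampleTensor x m v hn,
    centralFourth_sampleTensor x m v hn, sampleMoment, sampleMoment]
  simp only [← pow_succ, ← pow_two]
  ring

/-- The third central moment read off from the moment tensors. -/
noncomputable def centralThird (a : MomentIndex p → ℝ) (v : EuclideanSpace ℝ (Fin p)) : ℝ :=
  rawMoment 3 a v - 3 * rawMoment 2 a v * rawMoment 1 a v + 2 * rawMoment 1 a v ^ 3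

/-- The mixed moment `n⁻¹ ∑ (v'(xᵢ - m))ᵏ q'(xᵢ - m)`. -/
noncomputable def mixedMoment (x : ℕ → EuclideanSpace ℝ (Fin p))
    (m v q : EuclideanSpace ℝ (Fin p)) (k n : ℕ) : ℝ :=
  (n : ℝ)⁻¹ * ∑ i ∈ Finset.range n, ⟪v, x i - m⟫ ^ k * ⟪q, x i - m⟫

/-- Each term carries exactly one mixed moment, the only place where `q` enters. The coefficients
involve `v` alone and converge, so linearization amounts to freezing them. -/
theorem kurtosisScore_sampleTensor_eq_mixedMoment (x : ℕ → EuclideanSpace ℝ (Fin p))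
    (m v q : EuclideanSpace ℝ (Fin p)) {n : ℕ} (hn : n ≠ 0) :
    kurtosisScore (centralSecond (sampleTensor x m n)) (centralFourth (sampleTensor x m n)) v q =
      4 * (centralSecond (sampleTensor x m n) v * (mixedMoment x m v q 3 n -
          3 * rawMoment 1 (sampleTensor x m n) v * mixedMoment x m v q 2 n +
          3 * rawMoment 1 (sampleTensor x m n) v ^ 2 * mixedMoment x m v q 1 n -
          (rawMoment 1 (sampleTensor x m n) v ^ 3 + centralThird (sampleTensor x m n) v) *
            mixedMoment x m v q 0 n) -
        centralFourth (sampleTensor x m n) v * (mixedMoment x m v q 1 n -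
          rawMoment 1 (sampleTensor x m n) v * mixedMoment x m v q 0 n)) := by
  have hn' : (n : ℝ) ≠ 0 := Nat.cast_ne_zero.2 hn
  rw [kurtosisScore_sampleTensor x m v q hn]
  generalize centralSecond (sampleTensor x m n) v = A2
  generalize centralFourth (sampleTensor x m n) v = A4
  simp only [centralThird, rawMoment_sampleTensor, inner_sub_sampleMean x m v hn,
    inner_sub_sampleMean x m q hn, mixedMoment, Fin.val_two, Fin.val_one, pow_one, pow_zero,
    one_mul, show ((3 : Fin 5) : ℕ) = 3 from rfl]
  set r := (n : ℝ)⁻¹ * ∑ i ∈ Finset.range n, ⟪v, x i - m⟫ with hr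
  set s := (n : ℝ)⁻¹ * ∑ i ∈ Finset.range n, ⟪q, x i - m⟫ with hs
  have h1 : ∑ i ∈ Finset.range n, ⟪v, x i - m⟫ = n * r := by rw [hr]; field_simp
  have h2 : ∑ i ∈ Finset.range n, ⟪q, x i - m⟫ = n * s := by rw [hs]; field_simp
  generalize hz : (fun i => ⟪v, x i - m⟫) = z at *
  generalize hw : (fun i => ⟪q, x i - m⟫) = w at *
  have hz' : ∀ i, ⟪v, x i - m⟫ = z i := fun i => congrFun hz i
  have hw' : ∀ i, ⟪q, x i - m⟫ = w i := fun i => congrFun hw i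
  simp only [hz', hw'] at *
  have e3 : ∀ i, (z i - r) ^ 3 * (w i - s) = z i ^ 3 * w i - 3 * r * (z i ^ 2 * w i) +
      3 * r ^ 2 * (z i * w i) - r ^ 3 * w i - s * z i ^ 3 + 3 * r * s * z i ^ 2 -
      3 * r ^ 2 * s * z i + r ^ 3 * s := fun i => by ring
  have e1 : ∀ i, (z i - r) * (w i - s) = z i * w i - r * w i - s * z i + r * s :=
    fun i => by ring
  simp only [e3, e1, Finset.sum_add_distrib, Finset.sum_sub_distrib, ← Finset.mul_sum,
    Finset.sum_const, Finset.card_range, nsmul_eq_mul, h1, h2]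
  field_simp
  ring

theorem isBigO_mixedMoment (x : ℕ → EuclideanSpace ℝ (Fin p))
    (m v q : EuclideanSpace ℝ (Fin p)) {k N : ℕ} (hk : k < N) :
    mixedMoment x m v q k =O[atTop]
      (fun n => ∑ k ∈ Finset.range N, |mixedMoment x m v q k n|) := by
  refine IsBigO.of_bound 1 (Eventually.of_forall fun n => ?_)
  rw [one_mul, Real.norm_eq_abs, Real.norm_eq_abs]
  refine le_trans ?_ (le_abs_self _)
  exact Finset.single_le_sum (f := fun k => |mixedMoment x m v q k n|)
    (fun _ _ => abs_nonneg _) (Finset.mem_range.2 hk)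

/-- Linearization of the score of the sample in terms of mixed moments. -/
theorem isLittleO_kurtosisScore_sampleTensor (x : ℕ → EuclideanSpace ℝ (Fin p))
    (m v q : EuclideanSpace ℝ (Fin p)) {a₀ : MomentIndex p → ℝ}
    (ha : Tendsto (sampleTensor x m) atTop (𝓝 a₀)) (h1 : rawMoment 1 a₀ v = 0) :
    (fun n => kurtosisScore (centralSecond (sampleTensor x m n))
        (centralFourth (sampleTensor x m n)) v q -
      4 * (centralSecond a₀ v * (mixedMoment x m v q 3 n -
        centralThird a₀ v * mixedMoment x m v q 0 n) -
        centralFourth a₀ v * mixedMoment x m v q 1 n)) =o[atTop]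
      (fun n => ∑ k ∈ Finset.range 4, |mixedMoment x m v q k n|) := by
  have hR : ∀ k, Tendsto (fun n => rawMoment k (sampleTensor x m n) v) atTop
      (𝓝 (rawMoment k a₀ v)) := by
    intro k
    simp only [← rawMomentCLM_apply]
    exact ((rawMomentCLM k v).continuous.tendsto a₀).comp ha
  have hR1 := hR 1
  rw [h1] at hR1
  have hM2 : Tendsto (fun n => centralSecond (sampleTensor x m n) v) atTop
      (𝓝 (centralSecond a₀ v)) := (hR 2).sub ((hR 1).pow 2)
  have hM3 : Tendsto (fun n => centralThird (sampleTensor x m n) v) atTop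
      (𝓝 (centralThird a₀ v)) :=
    ((hR 3).sub (((hR 2).const_mul 3).mul (hR 1))).add (((hR 1).pow 3).const_mul 2)
  have hM4 : Tendsto (fun n => centralFourth (sampleTensor x m n) v) atTop
      (𝓝 (centralFourth a₀ v)) :=
    (((hR 4).sub (((hR 3).const_mul 4).mul (hR 1))).add (((hR 2).const_mul 6).mul
      ((hR 1).pow 2))).sub (((hR 1).pow 4).const_mul 3)
  have hB := fun k (hk : k < 4) => isBigO_mixedMoment x m v q hk
  have hmul : ∀ {c : ℕ → ℝ} {k : ℕ}, k < 4 → Tendsto c atTop (𝓝 0) →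
      (fun n => c n * mixedMoment x m v q k n) =o[atTop]
      (fun n => ∑ k ∈ Finset.range 4, |mixedMoment x m v q k n|) := by
    intro c k hk hc
    have := ((isLittleO_one_iff ℝ).2 hc).mul_isBigO (hB k hk)
    simpa using this
  -- `c3`, `c2`, `c1`, `c0` are the deviations of the coefficients of the mixed moments of orders 3
  -- to 0 from their limits; the order 2 coefficient itself vanishes in the limit because of `h1`.
  have c3 : Tendsto (fun n => 4 * (centralSecond (sampleTensor x m n) v - centralSecond a₀ v))
      atTop (𝓝 0) := by
    simpa using (hM2.sub_const (centralSecond a₀ v)).const_mul 4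
  have c2 : Tendsto (fun n => -(12 * (centralSecond (sampleTensor x m n) v *
      rawMoment 1 (sampleTensor x m n) v))) atTop (𝓝 0) := by
    simpa using ((hM2.mul hR1).const_mul 12).neg
  have c1 : Tendsto (fun n => 12 * (centralSecond (sampleTensor x m n) v *
      rawMoment 1 (sampleTensor x m n) v ^ 2) -
      4 * (centralFourth (sampleTensor x m n) v - centralFourth a₀ v)) atTop (𝓝 0) := by
    simpa using ((hM2.mul (hR1.pow 2)).const_mul 12).sub
      ((hM4.sub_const (centralFourth a₀ v)).const_mul 4)
  have c0 : Tendsto (fun n => -(4 * (centralSecond (sampleTensor x m n) v *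
      (rawMoment 1 (sampleTensor x m n) v ^ 3 + centralThird (sampleTensor x m n) v) -
      centralSecond a₀ v * centralThird a₀ v)) + 4 * (centralFourth (sampleTensor x m n) v *
      rawMoment 1 (sampleTensor x m n) v)) atTop (𝓝 0) := by
    simpa using ((((hM2.mul ((hR1.pow 3).add hM3)).sub_const
      (centralSecond a₀ v * centralThird a₀ v)).const_mul 4).neg).add
      ((hM4.mul hR1).const_mul 4)
  have := (((hmul (k := 3) (by norm_num) c3).add (hmul (k := 2) (by norm_num) c2)).add
    (hmul (k := 1) (by norm_num) c1)).add (hmul (k := 0) (by norm_num) c0)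
  refine this.congr' ?_ EventuallyEq.rfl
  filter_upwards [eventually_ne_atTop 0] with n hn
  rw [kurtosisScore_sampleTensor_eq_mixedMoment x m v q hn]
  ring

end Moments

/-! ### Moments of the univariate normal law. -/

section GaussianMoments

/-- Derivatives of the normal moment generating function are polynomials times the function; this is
the Hermite-type recursion for those polynomials. -/
theorem iteratedDeriv_succ_mul_exp {c v : ℝ} {k : ℕ} {H : ℝ → ℝ} {H' : ℝ → ℝ}
    (hk : iteratedDeriv k (fun t => Real.exp (c * t + v * t ^ 2 / 2)) =
      fun t => H t * Real.exp (c * t + v * t ^ 2 / 2))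
    (hH : ∀ t, HasDerivAt H (H' t) t) :
    iteratedDeriv (k + 1) (fun t => Real.exp (c * t + v * t ^ 2 / 2)) =
      fun t => (H' t + (c + v * t) * H t) * Real.exp (c * t + v * t ^ 2 / 2) := by
  rw [iteratedDeriv_succ, hk]
  funext t
  have h1 : HasDerivAt (fun t => c * t + v * t ^ 2 / 2) (c + v * t) t := by
    have := ((hasDerivAt_id t).const_mul c).add
      ((((hasDerivAt_id t).pow 2).const_mul v).div_const 2)
    refine this.congr_deriv ?_
    simp
    ring
  rw [((hH t).fun_mul h1.exp).deriv]
  ring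

/-- Order five is passed through but not recorded: squaring the leading term of the score produces
no fifth power. -/
theorem integral_pow_gaussianReal (c : ℝ) (v : ℝ≥0) :
    ∫ y, y ^ 1 ∂(gaussianReal c v) = c ∧
    ∫ y, y ^ 2 ∂(gaussianReal c v) = c ^ 2 + v ∧
    ∫ y, y ^ 3 ∂(gaussianReal c v) = c ^ 3 + 3 * v * c ∧
    ∫ y, y ^ 4 ∂(gaussianReal c v) = c ^ 4 + 6 * v * c ^ 2 + 3 * v ^ 2 ∧
    ∫ y, y ^ 6 ∂(gaussianReal c v) =
      c ^ 6 + 15 * v * c ^ 4 + 45 * v ^ 2 * c ^ 2 + 15 * v ^ 3 := by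
  have hmgf : ∀ k, ∫ y, y ^ k ∂(gaussianReal c v) =
      iteratedDeriv k (fun t => Real.exp (c * t + v * t ^ 2 / 2)) 0 := by
    intro k
    rw [← mgf_id_gaussianReal, iteratedDeriv_mgf_zero (by simp)]
    simp
  have hy : ∀ t : ℝ, HasDerivAt (fun t => c + v * t) (v : ℝ) t := fun t => by
    simpa using ((hasDerivAt_id t).const_mul (v : ℝ)).const_add c
  have h0 : iteratedDeriv 0 (fun t => Real.exp (c * t + v * t ^ 2 / 2)) =
      fun t => 1 * Real.exp (c * t + v * t ^ 2 / 2) := by simp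
  have h1 := iteratedDeriv_succ_mul_exp h0 fun t => hasDerivAt_const t (1 : ℝ)
  simp only [zero_add, mul_one] at h1
  have h2 := iteratedDeriv_succ_mul_exp h1 hy
  have d2 : ∀ t, HasDerivAt (fun t => v + (c + v * t) * (c + v * t)) (2 * (c + v * t) * v) t :=
    fun t => (((hy t).mul (hy t)).const_add (v : ℝ)).congr_deriv (by ring)
  have h3 := iteratedDeriv_succ_mul_exp h2 d2
  have e3 : ∀ t, 2 * (c + v * t) * v + (c + v * t) * (v + (c + v * t) * (c + v * t)) =
      (c + v * t) ^ 3 + 3 * v * (c + v * t) := fun t => by ring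
  simp only [e3] at h3
  have d3 : ∀ t, HasDerivAt (fun t => (c + v * t) ^ 3 + 3 * v * (c + v * t))
      (3 * (c + v * t) ^ 2 * v + 3 * v * v) t :=
    fun t => (((hy t).pow 3).add ((hy t).const_mul (3 * (v : ℝ)))).congr_deriv (by simp)
  have h4 := iteratedDeriv_succ_mul_exp h3 d3
  have e4 : ∀ t, 3 * (c + v * t) ^ 2 * v + 3 * v * v +
      (c + v * t) * ((c + v * t) ^ 3 + 3 * v * (c + v * t)) =
      (c + v * t) ^ 4 + 6 * v * (c + v * t) ^ 2 + 3 * v ^ 2 := fun t => by ring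
  simp only [e4] at h4
  have d4 : ∀ t, HasDerivAt (fun t => (c + v * t) ^ 4 + 6 * v * (c + v * t) ^ 2 + 3 * (v : ℝ) ^ 2)
      (4 * (c + v * t) ^ 3 * v + 12 * v * (c + v * t) * v) t :=
    fun t => ((((hy t).pow 4).add (((hy t).pow 2).const_mul (6 * (v : ℝ)))).add_const
      (3 * (v : ℝ) ^ 2)).congr_deriv (by simp; ring)
  have h5 := iteratedDeriv_succ_mul_exp h4 d4
  have e5 : ∀ t, 4 * (c + v * t) ^ 3 * v + 12 * v * (c + v * t) * v +
      (c + v * t) * ((c + v * t) ^ 4 + 6 * v * (c + v * t) ^ 2 + 3 * v ^ 2) =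
      (c + v * t) ^ 5 + 10 * v * (c + v * t) ^ 3 + 15 * v ^ 2 * (c + v * t) := fun t => by ring
  simp only [e5] at h5
  have d5 : ∀ t, HasDerivAt (fun t => (c + v * t) ^ 5 + 10 * v * (c + v * t) ^ 3 +
      15 * (v : ℝ) ^ 2 * (c + v * t))
      (5 * (c + v * t) ^ 4 * v + 30 * v * (c + v * t) ^ 2 * v + 15 * v ^ 2 * v) t :=
    fun t => ((((hy t).pow 5).add (((hy t).pow 3).const_mul (10 * (v : ℝ)))).add
      ((hy t).const_mul (15 * (v : ℝ) ^ 2))).congr_deriv (by simp; ring)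
  have h6 := iteratedDeriv_succ_mul_exp h5 d5
  refine ⟨?_, ?_, ?_, ?_, ?_⟩
  · rw [hmgf, h1]; simp
  · rw [hmgf, h2]; simp; ring
  · rw [hmgf, h3]; simp
  · rw [hmgf, h4]; simp
  · rw [hmgf, h6]; simp; ring

end GaussianMoments

/-! ### Projections of the multivariate normal law. -/

section Gaussian

variable {p : ℕ} {μ m : EuclideanSpace ℝ (Fin p)} {S : Matrix (Fin p) (Fin p) ℝ}

theorem covariance_inner_multivariateGaussian (hS : S.PosSemidef) (v q : EuclideanSpace ℝ (Fin p)) :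
    cov[fun x => ⟪v, x⟫, fun x => ⟪q, x⟫; multivariateGaussian μ S] =
      v.ofLp ⬝ᵥ S *ᵥ q.ofLp := by
  rw [← covarianceBilin_apply_eq_cov IsGaussian.memLp_two_id,
    covarianceBilin_multivariateGaussian hS]

theorem map_inner_sub_multivariateGaussian (hS : S.PosSemidef) (v : EuclideanSpace ℝ (Fin p)) :
    (multivariateGaussian μ S).map (fun x => ⟪v, x - m⟫) =
      gaussianReal ⟪v, μ - m⟫ (v.ofLp ⬝ᵥ S *ᵥ v.ofLp).toNNReal := by
  have h1 : (multivariateGaussian μ S).map (innerSL ℝ v) =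
      gaussianReal ⟪v, μ⟫ (v.ofLp ⬝ᵥ S *ᵥ v.ofLp).toNNReal := by
    rw [IsGaussian.map_eq_gaussianReal, IsGaussian.integral_dual,
      integral_id_multivariateGaussian, ← covariance_self (by fun_prop),
      ← covariance_inner_multivariateGaussian (μ := μ) hS]
    rfl
  have h2 : (fun x => ⟪v, x - m⟫) = (fun y : ℝ => y - ⟪v, m⟫) ∘ innerSL ℝ v := by
    funext x
    simp [inner_sub_right]
  rw [h2, ← Measure.map_map (by fun_prop) (by fun_prop), h1, gaussianReal_map_sub_const,
    inner_sub_right]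

theorem integral_inner_sub_pow_multivariateGaussian (hS : S.PosSemidef)
    (v : EuclideanSpace ℝ (Fin p)) (k : ℕ) :
    ∫ x, ⟪v, x - m⟫ ^ k ∂(multivariateGaussian μ S) =
      ∫ y, y ^ k ∂(gaussianReal ⟪v, μ - m⟫ (v.ofLp ⬝ᵥ S *ᵥ v.ofLp).toNNReal) := by
  rw [← map_inner_sub_multivariateGaussian hS, integral_map (by fun_prop) (by fun_prop)]

theorem indepFun_inner_sub_multivariateGaussian (hS : S.PosSemidef)
    {v q : EuclideanSpace ℝ (Fin p)} (h : v.ofLp ⬝ᵥ S *ᵥ q.ofLp = 0) :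
    IndepFun (fun x => ⟪v, x - m⟫) (fun x => ⟪q, x - m⟫) (multivariateGaussian μ S) := by
  have h1 : IndepFun (fun x => ⟪v, x⟫) (fun x => ⟪q, x⟫) (multivariateGaussian μ S) := by
    refine HasGaussianLaw.indepFun_of_covariance_eq_zero ?_ ?_
    · exact (IsGaussian.hasGaussianLaw_id (μ := multivariateGaussian μ S)).map
        ((innerSL ℝ v).prod (innerSL ℝ q))
    · rw [covariance_inner_multivariateGaussian hS, h]
  simp only [inner_sub_right]
  exact h1.comp (φ := fun y => y - ⟪v, m⟫) (ψ := fun y => y - ⟪q, m⟫) (by fun_prop) (by fun_prop)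

theorem integral_inner_mul_multivariateGaussian (hS : S.PosSemidef)
    {v q : EuclideanSpace ℝ (Fin p)} (h : v.ofLp ⬝ᵥ S *ᵥ q.ofLp = 0) (k l : ℕ) :
    ∫ x, ⟪v, x - m⟫ ^ k * ⟪q, x - m⟫ ^ l ∂(multivariateGaussian μ S) =
      (∫ x, ⟪v, x - m⟫ ^ k ∂(multivariateGaussian μ S)) *
        ∫ x, ⟪q, x - m⟫ ^ l ∂(multivariateGaussian μ S) := by
  have := (indepFun_inner_sub_multivariateGaussian (μ := μ) (m := m) hS h).comp
    (φ := fun y => y ^ k) (ψ := fun y => y ^ l) (by fun_prop) (by fun_prop)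
  exact this.integral_fun_mul_eq_mul_integral (by fun_prop) (by fun_prop)

end Gaussian

/-! ### Integrals and moments of the normal mixture. -/

section Mixture

variable {p : ℕ} (α : unitInterval) (μ₁ μ₂ : EuclideanSpace ℝ (Fin p))
  (S : Matrix (Fin p) (Fin p) ℝ)

/-- The mean of the normal mixture. -/
noncomputable def mixtureMean : EuclideanSpace ℝ (Fin p) :=
  (α : ℝ) • μ₁ + (1 - (α : ℝ)) • μ₂

theorem integrable_mixtureLaw {F : Type*} [NormedAddCommGroup F] {f : EuclideanSpace ℝ (Fin p) → F}
    (h₁ : Integrable f (multivariateGaussian μ₁ S))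
    (h₂ : Integrable f (multivariateGaussian μ₂ S)) : Integrable f (mixtureLaw α μ₁ μ₂ S) := by
  rw [mixtureLaw_eq]
  exact (h₁.smul_measure ENNReal.ofReal_ne_top).add_measure
    (h₂.smul_measure ENNReal.ofReal_ne_top)

theorem integral_mixtureLaw {F : Type*} [NormedAddCommGroup F] [NormedSpace ℝ F]
    {f : EuclideanSpace ℝ (Fin p) → F} (h₁ : Integrable f (multivariateGaussian μ₁ S))
    (h₂ : Integrable f (multivariateGaussian μ₂ S)) :
    ∫ x, f x ∂(mixtureLaw α μ₁ μ₂ S) = (α : ℝ) • ∫ x, f x ∂(multivariateGaussian μ₁ S) +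
      (1 - (α : ℝ)) • ∫ x, f x ∂(multivariateGaussian μ₂ S) := by
  rw [mixtureLaw_eq, integral_add_measure (h₁.smul_measure ENNReal.ofReal_ne_top)
    (h₂.smul_measure ENNReal.ofReal_ne_top), integral_smul_measure, integral_smul_measure,
    ENNReal.toReal_ofReal α.2.1, ENNReal.toReal_ofReal (sub_nonneg.2 α.2.2)]

theorem integrable_multivariateGaussian_of_norm_le {F : Type*} [NormedAddCommGroup F]
    [MeasurableSpace F] [BorelSpace F] [SecondCountableTopology F]
    {f : EuclideanSpace ℝ (Fin p) → F} (hf : Continuous f) (m μ : EuclideanSpace ℝ (Fin p))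
    {C : ℝ} {k : ℕ} (hC : ∀ x, ‖f x‖ ≤ C * ‖x - m‖ ^ k) :
    Integrable f (multivariateGaussian μ S) := by
  have h1 : Integrable (fun x => C * ‖x - m‖ ^ k) (multivariateGaussian μ S) := by
    refine Integrable.const_mul ?_ C
    rcases Nat.eq_zero_or_pos k with rfl | hk
    · simp
    · have h2 : MemLp (fun x => x - m) (k : ENNReal) (multivariateGaussian μ S) :=
        (IsGaussian.memLp_id _ _ (by simp)).sub (memLp_const m)
      exact h2.integrable_norm_pow hk.ne'
  exact h1.mono' hf.aestronglyMeasurable (Eventually.of_forall hC)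

theorem integrable_inner_pow_mul (μ m v q : EuclideanSpace ℝ (Fin p)) (k l : ℕ) :
    Integrable (fun x => ⟪v, x - m⟫ ^ k * ⟪q, x - m⟫ ^ l) (multivariateGaussian μ S) := by
  refine integrable_multivariateGaussian_of_norm_le S (by fun_prop) m μ
    (C := ‖v‖ ^ k * ‖q‖ ^ l) (k := k + l) fun x => ?_
  rw [norm_mul, norm_pow, norm_pow]
  calc _ ≤ (‖v‖ * ‖x - m‖) ^ k * (‖q‖ * ‖x - m‖) ^ l := by
        gcongr <;> exact norm_inner_le_norm _ _
    _ = _ := by ring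

theorem integrable_momentTensor (m : EuclideanSpace ℝ (Fin p)) :
    Integrable (fun x => momentTensor (x - m)) (mixtureLaw α μ₁ μ₂ S) := by
  have key : ∀ μ, Integrable (fun x => momentTensor (x - m)) (multivariateGaussian μ S) := by
    intro μ
    refine Integrable.of_eval fun I => ?_
    refine integrable_multivariateGaussian_of_norm_le S ?_ m μ (C := 1) (k := I.1) fun x => ?_
    · unfold momentTensor
      fun_prop
    · rw [momentTensor, norm_prod, one_mul]
      calc _ ≤ ∏ _j : Fin I.1, ‖x - m‖ :=
            Finset.prod_le_prod (fun _ _ => norm_nonneg _) fun j _ => PiLp.norm_apply_le _ _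
        _ = _ := by simp
  exact integrable_mixtureLaw α μ₁ μ₂ S (key μ₁) (key μ₂)

theorem inner_sub_mixtureMean_left (v : EuclideanSpace ℝ (Fin p)) :
    ⟪v, μ₁ - mixtureMean α μ₁ μ₂⟫ = -((1 - (α : ℝ)) * ⟪v, μ₂ - μ₁⟫) := by
  simp only [mixtureMean, inner_sub_right, inner_add_right, real_inner_smul_right]
  ring

theorem inner_sub_mixtureMean_right (v : EuclideanSpace ℝ (Fin p)) :
    ⟪v, μ₂ - mixtureMean α μ₁ μ₂⟫ = (α : ℝ) * ⟪v, μ₂ - μ₁⟫ := by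
  simp only [mixtureMean, inner_sub_right, inner_add_right, real_inner_smul_right]
  ring

variable {S}

theorem integral_inner_pow_mixtureLaw (hS : S.PosSemidef) (v : EuclideanSpace ℝ (Fin p)) (k : ℕ) :
    ∫ x, ⟪v, x - mixtureMean α μ₁ μ₂⟫ ^ k ∂(mixtureLaw α μ₁ μ₂ S) =
      (α : ℝ) * ∫ y, y ^ k ∂(gaussianReal (-((1 - (α : ℝ)) * ⟪v, μ₂ - μ₁⟫))
        (v.ofLp ⬝ᵥ S *ᵥ v.ofLp).toNNReal) +
      (1 - (α : ℝ)) * ∫ y, y ^ k ∂(gaussianReal ((α : ℝ) * ⟪v, μ₂ - μ₁⟫)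
        (v.ofLp ⬝ᵥ S *ᵥ v.ofLp).toNNReal) := by
  have h := fun μ => integrable_inner_pow_mul S μ (mixtureMean α μ₁ μ₂) v v k 0
  simp only [pow_zero, mul_one] at h
  rw [integral_mixtureLaw α μ₁ μ₂ S (h μ₁) (h μ₂),
    integral_inner_sub_pow_multivariateGaussian hS,
    integral_inner_sub_pow_multivariateGaussian hS, inner_sub_mixtureMean_left,
    inner_sub_mixtureMean_right, smul_eq_mul, smul_eq_mul]

/-- Centred at the mixture mean, the two components have means `-(1 - α) d` and `α d` and common
variance `Q`. All even orders are symmetric in `α` and `1 - α`, hence polynomials in `β`. -/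
theorem moments_mixtureLaw (hS : S.PosSemidef) (v : EuclideanSpace ℝ (Fin p)) {d Q β : ℝ}
    (hd : ⟪v, μ₂ - μ₁⟫ = d) (hQ : v.ofLp ⬝ᵥ S *ᵥ v.ofLp = Q) (hβ : (α : ℝ) * (1 - α) = β) :
    ∫ x, ⟪v, x - mixtureMean α μ₁ μ₂⟫ ^ 1 ∂(mixtureLaw α μ₁ μ₂ S) = 0 ∧
    ∫ x, ⟪v, x - mixtureMean α μ₁ μ₂⟫ ^ 2 ∂(mixtureLaw α μ₁ μ₂ S) = Q + β * d ^ 2 ∧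
    ∫ x, ⟪v, x - mixtureMean α μ₁ μ₂⟫ ^ 3 ∂(mixtureLaw α μ₁ μ₂ S) =
      β * (2 * α - 1) * d ^ 3 ∧
    ∫ x, ⟪v, x - mixtureMean α μ₁ μ₂⟫ ^ 4 ∂(mixtureLaw α μ₁ μ₂ S) =
      β * (1 - 3 * β) * d ^ 4 + 6 * Q * β * d ^ 2 + 3 * Q ^ 2 ∧
    ∫ x, ⟪v, x - mixtureMean α μ₁ μ₂⟫ ^ 6 ∂(mixtureLaw α μ₁ μ₂ S) =
      β * (1 - 5 * β + 5 * β ^ 2) * d ^ 6 + 15 * Q * β * (1 - 3 * β) * d ^ 4 +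
        45 * Q ^ 2 * β * d ^ 2 + 15 * Q ^ 3 := by
  have hQ0 : 0 ≤ Q := by
    rw [← hQ]
    simpa using hS.dotProduct_mulVec_nonneg v.ofLp
  have hc : ((v.ofLp ⬝ᵥ S *ᵥ v.ofLp).toNNReal : ℝ) = Q := by
    rw [hQ, Real.coe_toNNReal _ hQ0]
  simp only [integral_inner_pow_mixtureLaw α μ₁ μ₂ hS, hd]
  obtain ⟨a1, a2, a3, a4, a6⟩ := integral_pow_gaussianReal (-((1 - (α : ℝ)) * d))
    (v.ofLp ⬝ᵥ S *ᵥ v.ofLp).toNNReal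
  obtain ⟨b1, b2, b3, b4, b6⟩ := integral_pow_gaussianReal ((α : ℝ) * d)
    (v.ofLp ⬝ᵥ S *ᵥ v.ofLp).toNNReal
  rw [a1, a2, a3, a4, a6, b1, b2, b3, b4, b6, hc, ← hβ]
  refine ⟨?_, ?_, ?_, ?_, ?_⟩ <;> ring

/-- In directions `q` orthogonal to `μ₂ - μ₁`, projections of the mixture are normal, and
independent of the projections on directions `v` with `v'Sq = 0`. -/
theorem integral_inner_pow_mul_mixtureLaw (hS : S.PosSemidef) {v q : EuclideanSpace ℝ (Fin p)}
    (h : v.ofLp ⬝ᵥ S *ᵥ q.ofLp = 0) (hq : ⟪q, μ₂ - μ₁⟫ = 0) (k l : ℕ) :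
    ∫ x, ⟪v, x - mixtureMean α μ₁ μ₂⟫ ^ k * ⟪q, x - mixtureMean α μ₁ μ₂⟫ ^ l
      ∂(mixtureLaw α μ₁ μ₂ S) =
      (∫ x, ⟪v, x - mixtureMean α μ₁ μ₂⟫ ^ k ∂(mixtureLaw α μ₁ μ₂ S)) *
        ∫ y, y ^ l ∂(gaussianReal 0 (q.ofLp ⬝ᵥ S *ᵥ q.ofLp).toNNReal) := by
  have hi := fun μ => integrable_inner_pow_mul S μ (mixtureMean α μ₁ μ₂) v q k l
  have hi' := fun μ => integrable_inner_pow_mul S μ (mixtureMean α μ₁ μ₂) v v k 0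
  simp only [pow_zero, mul_one] at hi'
  rw [integral_mixtureLaw α μ₁ μ₂ S (hi μ₁) (hi μ₂),
    integral_mixtureLaw α μ₁ μ₂ S (hi' μ₁) (hi' μ₂),
    integral_inner_mul_multivariateGaussian hS h, integral_inner_mul_multivariateGaussian hS h,
    integral_inner_sub_pow_multivariateGaussian hS q, integral_inner_sub_pow_multivariateGaussian
    hS q, inner_sub_mixtureMean_left, inner_sub_mixtureMean_right, hq]
  simp only [mul_zero, neg_zero, smul_eq_mul]
  ring

end Mixture

/-! ### Negligible remainders and the Cramér–Wold device. -/

section General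

variable {Ω : Type*} [MeasurableSpace Ω] {P : Measure Ω} [IsProbabilityMeasure P]

/-- A sequence which is almost surely negligible with respect to a sequence bounded in `L¹`
tends to zero in probability. -/
theorem tendstoInMeasure_of_ae_isLittleO {D Y : ℕ → Ω → ℝ} (hD : ∀ n, AEMeasurable (D n) P)
    (hY : ∀ n, Integrable (Y n) P) (hY1 : ∀ n ω, 1 ≤ Y n ω) {C : ℝ}
    (hC : ∀ n, ∫ ω, Y n ω ∂P ≤ C)
    (h : ∀ᵐ ω ∂P, (fun n => D n ω) =o[atTop] (fun n => Y n ω)) :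
    TendstoInMeasure P D atTop 0 := by
  have hY0 : ∀ n ω, 0 < Y n ω := fun n ω => zero_lt_one.trans_le (hY1 n ω)
  have hratio : TendstoInMeasure P (fun n ω => D n ω / Y n ω) atTop (fun _ => (0 : ℝ)) := by
    refine tendstoInMeasure_of_tendsto_ae
      (fun n => ((hD n).div (hY n).aemeasurable).aestronglyMeasurable) ?_
    filter_upwards [h] with ω hω
    exact hω.tendsto_div_nhds_zero
  have hC0 : 0 ≤ C := (integral_nonneg fun ω => (hY0 0 ω).le).trans (hC 0)
  rw [tendstoInMeasure_iff_measureReal_dist] at hratio ⊢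
  intro ε hε
  rw [Metric.tendsto_atTop]
  intro η hη
  -- Chosen so that Markov's inequality gives `P(Y ≥ ε / c) ≤ C c / ε < η / 2`; the `+ 1` keeps the
  -- denominator positive and the inequality strict.
  set c := ε * η / (2 * (C + 1)) with hc
  have hc0 : 0 < c := by positivity
  obtain ⟨N, hN⟩ := (Metric.tendsto_atTop.1 (hratio c hc0)) (η / 2) (by positivity)
  refine ⟨N, fun n hn => ?_⟩
  have h1 := hN n hn
  simp only [Real.dist_eq, sub_zero, Pi.zero_apply] at h1 ⊢
  rw [abs_of_nonneg measureReal_nonneg] at h1 ⊢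
  have hsub : {ω | ε ≤ |D n ω|} ⊆ {ω | c ≤ |D n ω / Y n ω|} ∪ {ω | ε / c ≤ Y n ω} := by
    intro ω hω
    by_contra hcon
    simp only [Set.mem_union, Set.mem_ofPred_eq, not_or, not_le] at hcon hω
    obtain ⟨h2, h3⟩ := hcon
    rw [abs_div, abs_of_pos (hY0 n ω), div_lt_iff₀ (hY0 n ω)] at h2
    rw [lt_div_iff₀ hc0] at h3
    linarith [mul_comm c (Y n ω)]
  have hmarkov := mul_meas_ge_le_integral_of_nonneg
    (Eventually.of_forall fun ω => (hY0 n ω).le) (hY n) (ε / c)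
  have h4 : P.real {ω | ε / c ≤ Y n ω} < η / 2 := by
    have h5 : ε / c * P.real {ω | ε / c ≤ Y n ω} ≤ C := hmarkov.trans (hC n)
    have h6 : ε / c = 2 * (C + 1) / η := by
      rw [hc]
      field_simp
    rw [h6, div_mul_eq_mul_div, div_le_iff₀ hη] at h5
    by_contra hcon
    push Not at hcon
    have : 2 * (C + 1) * (η / 2) ≤ C * η :=
      le_trans (mul_le_mul_of_nonneg_left (by rw [h6] at hcon; exact hcon) (by positivity)) h5
    nlinarith
  calc P.real {ω | ε ≤ |D n ω|}
      ≤ P.real ({ω | c ≤ |D n ω / Y n ω|} ∪ {ω | ε / c ≤ Y n ω}) := measureReal_mono hsub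
    _ ≤ P.real {ω | c ≤ |D n ω / Y n ω|} + P.real {ω | ε / c ≤ Y n ω} := measureReal_union_le _ _
    _ < η := by linarith

/-- Cramér–Wold device for a multivariate normal limit. -/
theorem tendstoInDistribution_multivariateGaussian_of_inner {p : ℕ}
    {X : ℕ → Ω → EuclideanSpace ℝ (Fin p)} (hX : ∀ n, AEMeasurable (X n) P)
    {Ψ : Matrix (Fin p) (Fin p) ℝ} (hΨ : Ψ.PosSemidef)
    (h : ∀ t : EuclideanSpace ℝ (Fin p), TendstoInDistribution (fun n ω => ⟪t, X n ω⟫) atTop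
      (id : ℝ → ℝ) (fun _ => P) (gaussianReal 0 (t.ofLp ⬝ᵥ Ψ *ᵥ t.ofLp).toNNReal)) :
    TendstoInDistribution X atTop
      (id : EuclideanSpace ℝ (Fin p) → EuclideanSpace ℝ (Fin p)) (fun _ => P)
      (multivariateGaussian 0 Ψ) where
  forall_aemeasurable := hX
  tendsto := by
    refine ProbabilityMeasure.tendsto_iff_tendsto_charFun.2 fun t => ?_
    -- The characteristic function of `X n` at `t` is that of `⟪t, X n⟫` at `1`.
    have h1 := ProbabilityMeasure.tendsto_iff_tendsto_charFun.1 (h t).tendsto 1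
    have hnn : 0 ≤ t.ofLp ⬝ᵥ Ψ *ᵥ t.ofLp := by simpa using hΨ.dotProduct_mulVec_nonneg t.ofLp
    simp only [ProbabilityMeasure.coe_mk, Measure.map_id] at h1 ⊢
    rw [charFun_multivariateGaussian hΨ]
    rw [charFun_gaussianReal, Real.coe_toNNReal _ hnn] at h1
    convert h1 using 1
    · funext n
      have : AEMeasurable (fun ω => ⟪t, X n ω⟫) P := (h t).forall_aemeasurable n
      rw [charFun_apply, charFun_apply, integral_map (hX n) (by fun_prop),
        integral_map this (by fun_prop)]
      simp [real_inner_comm]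
    · simp

end General

/-! ### Normalized sums of iid variables. -/

section IID

variable {Ω : Type*} [MeasurableSpace Ω] {P : Measure Ω} [IsProbabilityMeasure P]
  {E : Type*} [MeasurableSpace E] {ν : Measure E} {x : ℕ → Ω → E}

/-- Central limit theorem for a centered square integrable function of iid observations. -/
theorem tendstoInDistribution_iid (hindep : iIndepFun x P) (hlaw : ∀ i, HasLaw (x i) ν P)
    {h : E → ℝ} (hm : Measurable h) (hL2 : MemLp h 2 ν) (h0 : ∫ y, h y ∂ν = 0) {σ : ℝ}
    (hσ : ∫ y, h y ^ 2 ∂ν = σ) :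
    TendstoInDistribution (fun (n : ℕ) ω => (√n)⁻¹ * ∑ i ∈ Finset.range n, h (x i ω)) atTop
      (id : ℝ → ℝ) (fun _ => P) (gaussianReal 0 σ.toNNReal) := by
  have hν : ν = P.map (x 0) := (hlaw 0).map_eq.symm
  have hident : ∀ i, IdentDistrib (h ∘ x i) (h ∘ x 0) P P := fun i =>
    IdentDistrib.comp ⟨(hlaw i).aemeasurable, (hlaw 0).aemeasurable,
      (hlaw i).map_eq.trans (hlaw 0).map_eq.symm⟩ hm
  have hmean : P[h ∘ x 0] = 0 := by
    rw [(hlaw 0).integral_comp hm.aestronglyMeasurable, h0]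
  have hvar : Var[h ∘ x 0; P] = σ := by
    rw [variance_of_integral_eq_zero (hm.comp_aemeasurable (hlaw 0).aemeasurable) hmean, ← hσ]
    exact (hlaw 0).integral_comp (f := fun y => h y ^ 2) (hm.pow_const 2).aestronglyMeasurable
  have hmem : MemLp (h ∘ x 0) 2 P := by
    rw [hν] at hL2
    exact (memLp_map_measure_iff hL2.aestronglyMeasurable (hlaw 0).aemeasurable).1 hL2
  have hY : HasLaw (id : ℝ → ℝ) (gaussianReal 0 Var[h ∘ x 0; P].toNNReal)
      (gaussianReal 0 σ.toNNReal) := by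
    rw [hvar]
    exact HasLaw.id
  have := tendstoInDistribution_inv_sqrt_mul_sum_sub (X := fun i => h ∘ x i) hY hmem
    (hindep.comp (fun _ => h) fun _ => hm) hident
  simp only [hmean, mul_zero, sub_zero] at this
  exact this

theorem integral_sq_normalized_sum_le (hindep : iIndepFun x P) (hlaw : ∀ i, HasLaw (x i) ν P)
    {h : E → ℝ} (hm : Measurable h) (hL2 : MemLp h 2 ν) (h0 : ∫ y, h y ∂ν = 0) (n : ℕ) :
    Integrable (fun ω => (√n * ((n : ℝ)⁻¹ * ∑ i ∈ Finset.range n, h (x i ω))) ^ 2) P ∧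
    ∫ ω, (√n * ((n : ℝ)⁻¹ * ∑ i ∈ Finset.range n, h (x i ω))) ^ 2 ∂P ≤ ∫ y, h y ^ 2 ∂ν := by
  have hmem : ∀ i, MemLp (h ∘ x i) 2 P := fun i => by
    have h1 := hL2
    rw [← (hlaw i).map_eq] at h1
    exact (memLp_map_measure_iff h1.aestronglyMeasurable (hlaw i).aemeasurable).1 h1
  have hsum : MemLp (∑ i ∈ Finset.range n, h ∘ x i) 2 P :=
    memLp_finsetSum' _ fun i _ => hmem i
  have hmean : ∀ i, P[h ∘ x i] = 0 := fun i => by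
    rw [(hlaw i).integral_comp hm.aestronglyMeasurable, h0]
  have hsummean : P[∑ i ∈ Finset.range n, h ∘ x i] = 0 := by
    simp only [Finset.sum_apply]
    rw [integral_finsetSum _ fun i _ => (hmem i).integrable (by norm_num)]
    exact Finset.sum_eq_zero fun i _ => hmean i
  have hvar : ∀ i, Var[h ∘ x i; P] = ∫ y, h y ^ 2 ∂ν := fun i => by
    rw [variance_of_integral_eq_zero (hm.comp_aemeasurable (hlaw i).aemeasurable) (hmean i)]
    exact (hlaw i).integral_comp (f := fun y => h y ^ 2) (hm.pow_const 2).aestronglyMeasurable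
  have hvs : ∫ ω, (∑ i ∈ Finset.range n, h (x i ω)) ^ 2 ∂P = n * ∫ y, h y ^ 2 ∂ν := by
    have h1 := IndepFun.variance_sum (s := Finset.range n) (fun i _ => hmem i)
      (fun i _ j _ hij => (hindep.indepFun hij).comp hm hm)
    rw [variance_of_integral_eq_zero hsum.aemeasurable hsummean] at h1
    simpa [hvar] using h1
  have hint : Integrable (fun ω => (∑ i ∈ Finset.range n, h (x i ω)) ^ 2) P := by
    simpa using hsum.integrable_sq
  simp only [← mul_assoc, mul_pow]
  refine ⟨hint.const_mul _, ?_⟩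
  rw [integral_const_mul, hvs]
  -- Equality holds for positive `n`; the empty sum is the reason for stating an inequality.
  rcases Nat.eq_zero_or_pos n with rfl | hn
  · simp
    exact integral_nonneg fun y => sq_nonneg _
  · have hn' : (0 : ℝ) < n := Nat.cast_pos.2 hn
    rw [Real.sq_sqrt hn'.le]
    apply le_of_eq
    field_simp

end IID

/-! ### Bookkeeping for integrals of linear combinations. -/

section HasMean

variable {E : Type*} [MeasurableSpace E] {ν : Measure E}

/-- `f` is integrable with integral `a`. -/
def HasMean (ν : Measure E) (f : E → ℝ) (a : ℝ) : Prop := Integrable f ν ∧ ∫ y, f y ∂ν = a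

theorem HasMean.add {f g : E → ℝ} {a b : ℝ} (hf : HasMean ν f a) (hg : HasMean ν g b) :
    HasMean ν (fun y => f y + g y) (a + b) :=
  ⟨hf.1.add hg.1, by rw [integral_add hf.1 hg.1, hf.2, hg.2]⟩

theorem HasMean.sub {f g : E → ℝ} {a b : ℝ} (hf : HasMean ν f a) (hg : HasMean ν g b) :
    HasMean ν (fun y => f y - g y) (a - b) :=
  ⟨hf.1.sub hg.1, by rw [integral_sub hf.1 hg.1, hf.2, hg.2]⟩

theorem HasMean.const_mul {f : E → ℝ} {a : ℝ} (hf : HasMean ν f a) (c : ℝ) :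
    HasMean ν (fun y => c * f y) (c * a) :=
  ⟨hf.1.const_mul c, by rw [integral_const_mul, hf.2]⟩

end HasMean

/-! ### Limit theorems for the mixture sample. -/

section Mixture

variable {Ω : Type*} [MeasurableSpace Ω] {P : Measure Ω} {p : ℕ}
  {α : unitInterval} {μ₁ μ₂ : EuclideanSpace ℝ (Fin p)} {S : Matrix (Fin p) (Fin p) ℝ}
  {x : ℕ → Ω → EuclideanSpace ℝ (Fin p)}

variable (α μ₁ μ₂ S) in
/-- The moment tensors of the normal mixture centered at its mean. -/
noncomputable def mixtureTensor : MomentIndex p → ℝ :=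
  ∫ x, momentTensor (x - mixtureMean α μ₁ μ₂) ∂(mixtureLaw α μ₁ μ₂ S)

theorem continuous_momentTensor : Continuous (momentTensor (p := p)) := by
  unfold momentTensor
  fun_prop

theorem rawMoment_mixtureTensor (k : Fin 5) (v : EuclideanSpace ℝ (Fin p)) :
    rawMoment k (mixtureTensor α μ₁ μ₂ S) v =
      ∫ x, ⟪v, x - mixtureMean α μ₁ μ₂⟫ ^ (k : ℕ) ∂(mixtureLaw α μ₁ μ₂ S) := by
  rw [← rawMomentCLM_apply, mixtureTensor,
    ← ContinuousLinearMap.integral_comp_comm _ (integrable_momentTensor α μ₁ μ₂ S _)]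
  simp only [rawMomentCLM_apply, rawMoment_momentTensor]

theorem ae_tendsto_sampleTensor (hindep : iIndepFun x P)
    (hlaw : ∀ i, HasLaw (x i) (mixtureLaw α μ₁ μ₂ S) P) :
    ∀ᵐ ω ∂P, Tendsto (sampleTensor (fun i => x i ω) (mixtureMean α μ₁ μ₂)) atTop
      (𝓝 (mixtureTensor α μ₁ μ₂ S)) := by
  set m := mixtureMean α μ₁ μ₂ with hm
  set f : EuclideanSpace ℝ (Fin p) → (MomentIndex p → ℝ) := fun y => momentTensor (y - m) with hf
  have hfc : Continuous f := continuous_momentTensor.comp (continuous_id.sub continuous_const)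
  have hint : Integrable (f ∘ x 0) P := by
    have h1 := integrable_momentTensor α μ₁ μ₂ S m
    rw [← (hlaw 0).map_eq] at h1
    exact (integrable_map_measure hfc.aestronglyMeasurable (hlaw 0).aemeasurable).1 h1
  have h := strong_law_ae (fun i => f ∘ x i) hint
    (fun i j hij => (hindep.indepFun hij).comp hfc.measurable hfc.measurable)
    (fun i => IdentDistrib.comp ⟨(hlaw i).aemeasurable, (hlaw 0).aemeasurable,
      (hlaw i).map_eq.trans (hlaw 0).map_eq.symm⟩ hfc.measurable)
  rw [(hlaw 0).integral_comp hfc.aestronglyMeasurable] at h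
  exact h

/-- The normal part has no third or fourth cumulant, so what remains are the cumulants `β (2α - 1)
d³` and `β (1 - 6β) d⁴` of the two-point shift. -/
theorem centralMoments_mixtureTensor (hS : S.PosSemidef) {β : ℝ}
    (hβ : (α : ℝ) * (1 - α) = β) (v : EuclideanSpace ℝ (Fin p)) :
    rawMoment 1 (mixtureTensor α μ₁ μ₂ S) v = 0 ∧
    centralSecond (mixtureTensor α μ₁ μ₂ S) v =
      v.ofLp ⬝ᵥ S *ᵥ v.ofLp + β * ⟪v, μ₂ - μ₁⟫ ^ 2 ∧
    centralThird (mixtureTensor α μ₁ μ₂ S) v = β * (2 * α - 1) * ⟪v, μ₂ - μ₁⟫ ^ 3 ∧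
    centralFourth (mixtureTensor α μ₁ μ₂ S) v =
      3 * centralSecond (mixtureTensor α μ₁ μ₂ S) v ^ 2 +
        β * (1 - 6 * β) * ⟪v, μ₂ - μ₁⟫ ^ 4 := by
  obtain ⟨h1, h2, h3, h4, -⟩ := moments_mixtureLaw α μ₁ μ₂ hS v rfl rfl hβ
  have e1 : rawMoment 1 (mixtureTensor α μ₁ μ₂ S) v = 0 := (rawMoment_mixtureTensor 1 v).trans h1
  have e2 := (rawMoment_mixtureTensor 2 v).trans h2
  have e3 := (rawMoment_mixtureTensor 3 v).trans h3
  have e4 := (rawMoment_mixtureTensor 4 v).trans h4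
  refine ⟨e1, ?_, ?_, ?_⟩
  · rw [centralSecond, e1, e2]; ring
  · rw [centralThird, e1, e2, e3]; ring
  · rw [centralFourth, centralSecond, e1, e2, e3, e4]; ring

/-- The square of the scaled mixed moments is bounded in `L¹`. -/
theorem exists_integral_mixedMoment_sq_le [IsProbabilityMeasure P] (hS : S.PosSemidef)
    (hindep : iIndepFun x P)
    (hlaw : ∀ i, HasLaw (x i) (mixtureLaw α μ₁ μ₂ S) P) {v q : EuclideanSpace ℝ (Fin p)}
    (h : v.ofLp ⬝ᵥ S *ᵥ q.ofLp = 0) (hq : ⟪q, μ₂ - μ₁⟫ = 0) (k : ℕ) :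
    (∀ n : ℕ, Integrable (fun ω => (√n * mixedMoment (fun i => x i ω)
      (mixtureMean α μ₁ μ₂) v q k n) ^ 2) P) ∧
    ∃ C, ∀ n : ℕ, ∫ ω, (√n * mixedMoment (fun i => x i ω)
      (mixtureMean α μ₁ μ₂) v q k n) ^ 2 ∂P ≤ C := by
  set m := mixtureMean α μ₁ μ₂ with hm
  set f : EuclideanSpace ℝ (Fin p) → ℝ := fun y => ⟪v, y - m⟫ ^ k * ⟪q, y - m⟫ with hf
  have hfc : Continuous f := by rw [hf]; fun_prop
  have hL2 : MemLp f 2 (mixtureLaw α μ₁ μ₂ S) := by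
    rw [memLp_two_iff_integrable_sq hfc.aestronglyMeasurable]
    have h1 := integrable_mixtureLaw α μ₁ μ₂ S
      (integrable_inner_pow_mul S μ₁ m v q (k * 2) 2)
      (integrable_inner_pow_mul S μ₂ m v q (k * 2) 2)
    simpa only [hf, mul_pow, ← pow_mul] using h1
  have h0 : ∫ y, f y ∂(mixtureLaw α μ₁ μ₂ S) = 0 := by
    have h1 := integral_inner_pow_mul_mixtureLaw α μ₁ μ₂ hS h hq k 1
    rw [(integral_pow_gaussianReal _ _).1, mul_zero] at h1
    simpa only [pow_one] using h1
  have h2 := integral_sq_normalized_sum_le hindep hlaw hfc.measurable hL2 h0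
  exact ⟨fun n => (h2 n).1, _, fun n => (h2 n).2⟩

/-- Asymptotic normality of the leading term of the score in the direction `q`. -/
theorem tendstoInDistribution_leading_term [IsProbabilityMeasure P] (hS : S.PosSemidef)
    (hindep : iIndepFun x P)
    (hlaw : ∀ i, HasLaw (x i) (mixtureLaw α μ₁ μ₂ S) P) {v q : EuclideanSpace ℝ (Fin p)}
    (h : v.ofLp ⬝ᵥ S *ᵥ q.ofLp = 0) (hq : ⟪q, μ₂ - μ₁⟫ = 0) {β τ : ℝ}
    (hβ : (α : ℝ) * (1 - α) = β) (hv : v.ofLp ⬝ᵥ S *ᵥ v.ofLp = τ) (hvd : ⟪v, μ₂ - μ₁⟫ = τ)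
    (ρ : ℝ) :
    TendstoInDistribution (fun (n : ℕ) ω => √n * (ρ *
      (centralSecond (mixtureTensor α μ₁ μ₂ S) v *
        (mixedMoment (fun i => x i ω) (mixtureMean α μ₁ μ₂) v q 3 n -
          centralThird (mixtureTensor α μ₁ μ₂ S) v *
            mixedMoment (fun i => x i ω) (mixtureMean α μ₁ μ₂) v q 0 n) -
        centralFourth (mixtureTensor α μ₁ μ₂ S) v *
          mixedMoment (fun i => x i ω) (mixtureMean α μ₁ μ₂) v q 1 n))) atTop
      (id : ℝ → ℝ) (fun _ => P) (gaussianReal 0 (ρ ^ 2 * (τ ^ 5 * (1 + β * τ) *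
        (6 + 24 * β * τ + 9 * β * (1 - 2 * β) * τ ^ 2 + β * (1 - 3 * β) * τ ^ 3)) *
        (q.ofLp ⬝ᵥ S *ᵥ q.ofLp)).toNNReal) := by
  obtain ⟨-, c2, c3, c4⟩ := centralMoments_mixtureTensor (μ₁ := μ₁) (μ₂ := μ₂) hS hβ v
  rw [c4, c2, c3, hv, hvd]
  set m := mixtureMean α μ₁ μ₂ with hm
  set m2 := τ + β * τ ^ 2 with hm2
  set m3 := β * (2 * α - 1) * τ ^ 3 with hm3
  set m4 := 3 * m2 ^ 2 + β * (1 - 6 * β) * τ ^ 4 with hm4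
  have hqq : 0 ≤ q.ofLp ⬝ᵥ S *ᵥ q.ofLp := by simpa using hS.dotProduct_mulVec_nonneg q.ofLp
  set s := q.ofLp ⬝ᵥ S *ᵥ q.ofLp with hs
  set f : EuclideanSpace ℝ (Fin p) → ℝ := fun y =>
    ρ * (m2 * (⟪v, y - m⟫ ^ 3 * ⟪q, y - m⟫ - m3 * ⟪q, y - m⟫) - m4 * (⟪v, y - m⟫ * ⟪q, y - m⟫))
    with hf
  have hfc : Continuous f := by rw [hf]; fun_prop
  have hi := fun k l => integrable_mixtureLaw α μ₁ μ₂ S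
    (integrable_inner_pow_mul S μ₁ m v q k l) (integrable_inner_pow_mul S μ₂ m v q k l)
  have hprod := integral_inner_pow_mul_mixtureLaw α μ₁ μ₂ hS h hq
  rw [← hm, ← hs] at hprod
  obtain ⟨g1, g2, -, -, -⟩ := integral_pow_gaussianReal 0 s.toNNReal
  rw [Real.coe_toNNReal _ hqq] at g2
  have hf1 : ∀ y, f y = (ρ * m2) * (⟪v, y - m⟫ ^ 3 * ⟪q, y - m⟫ ^ 1) -
      (ρ * m2 * m3) * (⟪v, y - m⟫ ^ 0 * ⟪q, y - m⟫ ^ 1) -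
      (ρ * m4) * (⟪v, y - m⟫ ^ 1 * ⟪q, y - m⟫ ^ 1) := fun y => by rw [hf]; ring
  have hf2 : ∀ y, f y ^ 2 = (ρ ^ 2 * m2 ^ 2) * (⟪v, y - m⟫ ^ 6 * ⟪q, y - m⟫ ^ 2) +
      (ρ ^ 2 * m4 ^ 2) * (⟪v, y - m⟫ ^ 2 * ⟪q, y - m⟫ ^ 2) +
      (ρ ^ 2 * m2 ^ 2 * m3 ^ 2) * (⟪v, y - m⟫ ^ 0 * ⟪q, y - m⟫ ^ 2) -
      (2 * ρ ^ 2 * m2 * m4) * (⟪v, y - m⟫ ^ 4 * ⟪q, y - m⟫ ^ 2) -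
      (2 * ρ ^ 2 * m2 ^ 2 * m3) * (⟪v, y - m⟫ ^ 3 * ⟪q, y - m⟫ ^ 2) +
      (2 * ρ ^ 2 * m2 * m3 * m4) * (⟪v, y - m⟫ ^ 1 * ⟪q, y - m⟫ ^ 2) := fun y => by
    rw [hf]; ring
  obtain ⟨k1, k2, k3, k4, k6⟩ := moments_mixtureLaw α μ₁ μ₂ hS v hvd hv hβ
  have : IsProbabilityMeasure (mixtureLaw α μ₁ μ₂ S) := (hlaw 0).isProbabilityMeasure_iff.1 ‹_›
  have k0 : ∫ x, ⟪v, x - m⟫ ^ 0 ∂(mixtureLaw α μ₁ μ₂ S) = 1 := by simp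
  have hb := fun k l c => HasMean.const_mul ⟨hi k l, hprod k l⟩ c
  have h0 : ∫ y, f y ∂(mixtureLaw α μ₁ μ₂ S) = 0 := by
    rw [funext hf1, (((hb 3 1 _).sub (hb 0 1 _)).sub (hb 1 1 _)).2, g1]
    ring
  have hsq := (((((hb 6 2 (ρ ^ 2 * m2 ^ 2)).add (hb 2 2 (ρ ^ 2 * m4 ^ 2))).add
    (hb 0 2 (ρ ^ 2 * m2 ^ 2 * m3 ^ 2))).sub (hb 4 2 (2 * ρ ^ 2 * m2 * m4))).sub
    (hb 3 2 (2 * ρ ^ 2 * m2 ^ 2 * m3))).add (hb 1 2 (2 * ρ ^ 2 * m2 * m3 * m4))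
  rw [← funext hf2] at hsq
  have hL2 : MemLp f 2 (mixtureLaw α μ₁ μ₂ S) := by
    rw [memLp_two_iff_integrable_sq hfc.aestronglyMeasurable]
    exact hsq.1
  have hσ : ∫ y, f y ^ 2 ∂(mixtureLaw α μ₁ μ₂ S) = ρ ^ 2 * (τ ^ 5 * (1 + β * τ) *
        (6 + 24 * β * τ + 9 * β * (1 - 2 * β) * τ ^ 2 + β * (1 - 3 * β) * τ ^ 3)) * s := by
    rw [hsq.2, g2, k0, k1, k2, k3, k4, k6, hm4, hm3, hm2]
    -- The third moment enters the variance only through its square, so the result depends on `α`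
    -- through `β` alone.
    have hα2 : (2 * (α : ℝ) - 1) ^ 2 = 1 - 4 * β := by rw [← hβ]; ring
    linear_combination (-(ρ ^ 2 * (τ + β * τ ^ 2) ^ 2 * β ^ 2 * τ ^ 6 * s)) * hα2
  have hclt := tendstoInDistribution_iid hindep hlaw hfc.measurable hL2 h0 hσ
  refine hclt.congr (fun n => Eventually.of_forall fun ω => ?_) EventuallyEq.rfl
  simp only [mixedMoment, hf, ← Finset.mul_sum, Finset.sum_sub_distrib, pow_zero, one_mul, pow_one]
  rcases Nat.eq_zero_or_pos n with rfl | hn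
  · simp
  · have hn' : (0 : ℝ) < √n := Real.sqrt_pos.2 (Nat.cast_pos.2 hn)
    have : (n : ℝ)⁻¹ = (√n)⁻¹ * (√n)⁻¹ := by
      rw [← mul_inv, Real.mul_self_sqrt (Nat.cast_nonneg n)]
    rw [this]
    field_simp

end Mixture

/-! ### Control of the remainder by an envelope. -/

section Remainder

variable {p : ℕ}

theorem isBigO_kurtosisScore_sampleTensor (x : ℕ → EuclideanSpace ℝ (Fin p))
    (m v q : EuclideanSpace ℝ (Fin p)) {a₀ : MomentIndex p → ℝ}
    (ha : Tendsto (sampleTensor x m) atTop (𝓝 a₀)) (h1 : rawMoment 1 a₀ v = 0) :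
    (fun n => kurtosisScore (centralSecond (sampleTensor x m n))
        (centralFourth (sampleTensor x m n)) v q) =O[atTop]
      (fun n => ∑ k ∈ Finset.range 4, |mixedMoment x m v q k n|) := by
  have hB := fun k (hk : k < 4) => isBigO_mixedMoment x m v q hk
  have hmain := (((hB 3 (by norm_num)).sub ((hB 0 (by norm_num)).const_mul_left
    (centralThird a₀ v))).const_mul_left (centralSecond a₀ v)).sub
    ((hB 1 (by norm_num)).const_mul_left (centralFourth a₀ v))
  refine ((isLittleO_kurtosisScore_sampleTensor x m v q ha h1).isBigO.add
    (hmain.const_mul_left 4)).congr_left fun n => ?_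
  ring

/-- The directions orthogonal to `δ` obtained from the standard basis, together with `q`. -/
noncomputable def orthDirection (δ θ q : EuclideanSpace ℝ (Fin p)) :
    Option (Fin p) → EuclideanSpace ℝ (Fin p)
  | none => q
  | some j => EuclideanSpace.single j 1 - (⟪δ, EuclideanSpace.single j 1⟫ / ⟪δ, θ⟫) • θ

theorem inner_orthDirection {δ θ q : EuclideanSpace ℝ (Fin p)} (hδ : ⟪δ, θ⟫ ≠ 0)
    (hq : ⟪δ, q⟫ = 0) (o : Option (Fin p)) : ⟪δ, orthDirection δ θ q o⟫ = 0 := by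
  cases o with
  | none => exact hq
  | some j =>
    simp only [orthDirection, inner_sub_right, real_inner_smul_right]
    field_simp
    ring

/-- The envelope of the scaled mixed moments that controls the remainder terms. -/
noncomputable def momentEnvelope (x : ℕ → EuclideanSpace ℝ (Fin p))
    (m δ θ q : EuclideanSpace ℝ (Fin p)) (n : ℕ) : ℝ :=
  1 + ∑ o, ∑ k ∈ Finset.range 4, (√n * mixedMoment x m θ (orthDirection δ θ q o) k n) ^ 2

theorem isBigO_momentEnvelope (x : ℕ → EuclideanSpace ℝ (Fin p))
    (m δ θ q : EuclideanSpace ℝ (Fin p)) (o : Option (Fin p)) :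
    (fun n : ℕ => √n * ∑ k ∈ Finset.range 4, |mixedMoment x m θ (orthDirection δ θ q o) k n|)
      =O[atTop] (momentEnvelope x m δ θ q) := by
  simp only [Finset.mul_sum]
  refine IsBigO.fun_sum fun k hk => IsBigO.of_bound 1 (Eventually.of_forall fun n => ?_)
  have h1 : (√n * mixedMoment x m θ (orthDirection δ θ q o) k n) ^ 2 ≤
      ∑ o, ∑ k ∈ Finset.range 4, (√n * mixedMoment x m θ (orthDirection δ θ q o) k n) ^ 2 := by
    refine le_trans ?_ (Finset.single_le_sum
      (f := fun o => ∑ k ∈ Finset.range 4, (√n * mixedMoment x m θ (orthDirection δ θ q o) k n) ^ 2)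
      (fun o _ => Finset.sum_nonneg fun k _ => sq_nonneg _) (Finset.mem_univ o))
    exact Finset.single_le_sum
      (f := fun k => (√n * mixedMoment x m θ (orthDirection δ θ q o) k n) ^ 2)
      (fun k _ => sq_nonneg _) hk
  rw [one_mul, norm_mul, Real.norm_eq_abs, Real.norm_eq_abs, Real.norm_eq_abs, abs_abs, ← abs_mul]
  refine le_trans ?_ (le_abs_self _)
  unfold momentEnvelope
  set b := √n * mixedMoment x m θ (orthDirection δ θ q o) k n
  -- Squares are used because their expectations are bounded by variances; the summand `1` in the
  -- envelope pays for this and keeps it away from zero.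
  have : |b| ≤ 1 + b ^ 2 := by
    rw [← sq_abs]
    nlinarith [sq_nonneg (|b| - 1), abs_nonneg b]
  linarith

/-- The operator norm is bounded by the values on the standard basis. Since the score at `θ`
annihilates `θ`, each basis vector may be replaced by its `orthDirection`, for which the mixed
moments of the mixture sample have mean zero. -/
theorem isBigO_sqrt_mul_norm_kurtosisScore (x : ℕ → EuclideanSpace ℝ (Fin p))
    (m : EuclideanSpace ℝ (Fin p)) {δ θ : EuclideanSpace ℝ (Fin p)}
    (q : EuclideanSpace ℝ (Fin p)) {a₀ : MomentIndex p → ℝ}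
    (ha : Tendsto (sampleTensor x m) atTop (𝓝 a₀)) (h1 : rawMoment 1 a₀ θ = 0) :
    (fun n : ℕ => √n * ‖kurtosisScore (centralSecond (sampleTensor x m n))
        (centralFourth (sampleTensor x m n)) θ‖) =O[atTop] (momentEnvelope x m δ θ q) := by
  set Φ := fun n => kurtosisScore (centralSecond (sampleTensor x m n))
        (centralFourth (sampleTensor x m n)) θ with hΦ
  have hcomp : ∀ j, (fun n : ℕ => √n * Φ n (EuclideanSpace.single j 1)) =O[atTop]
      (momentEnvelope x m δ θ q) := by
    intro j
    refine IsBigO.trans ?_ (isBigO_momentEnvelope x m δ θ q (some j))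
    refine ((isBigO_refl (fun n : ℕ => √n) atTop).mul
      (isBigO_kurtosisScore_sampleTensor x m θ (orthDirection δ θ q (some j)) ha h1)).congr' ?_
      EventuallyEq.rfl
    filter_upwards [eventually_ne_atTop 0] with n hn
    simp only [orthDirection, map_sub, map_smul, kurtosisScore_sampleTensor_self x m θ hn, hΦ,
      smul_zero, sub_zero]
  have hbound : ∀ n, ‖Φ n‖ ≤ ∑ j, |Φ n (EuclideanSpace.single j 1)| := by
    intro n
    refine ContinuousLinearMap.opNorm_le_bound _ (Finset.sum_nonneg fun _ _ => abs_nonneg _)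
      fun v => ?_
    have hv : v = ∑ j, v j • EuclideanSpace.single j (1 : ℝ) := by
      simpa using ((EuclideanSpace.basisFun (Fin p) ℝ).sum_repr v).symm
    conv_lhs => rw [hv, map_sum]
    refine (norm_sum_le _ _).trans ?_
    rw [Finset.sum_mul]
    refine Finset.sum_le_sum fun j _ => ?_
    rw [map_smul, norm_smul, mul_comm, Real.norm_eq_abs (Φ n _)]
    exact mul_le_mul_of_nonneg_left (PiLp.norm_apply_le _ _) (abs_nonneg _)
  have hsum : (fun n : ℕ => ∑ j, |√n * Φ n (EuclideanSpace.single j 1)|) =O[atTop]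
      (momentEnvelope x m δ θ q) := IsBigO.fun_sum fun j _ => (hcomp j).abs_left
  refine IsBigO.trans (IsBigO.of_bound 1 (Eventually.of_forall fun n => ?_)) hsum
  rw [one_mul, norm_mul, norm_norm, Real.norm_of_nonneg (Real.sqrt_nonneg _), Real.norm_eq_abs]
  refine le_trans ?_ (le_abs_self _)
  simp only [abs_mul, abs_of_nonneg (Real.sqrt_nonneg _), ← Finset.mul_sum]
  exact mul_le_mul_of_nonneg_left (hbound n) (Real.sqrt_nonneg _)

/-- The remainder in the linearization of the scaled maximizers is negligible with respect to
the envelope. -/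
theorem isLittleO_remainder (x : ℕ → EuclideanSpace ℝ (Fin p))
    (m : EuclideanSpace ℝ (Fin p)) {δ θ q t u₀ : EuclideanSpace ℝ (Fin p)}
    {a₀ : MomentIndex p → ℝ}
    (ha : Tendsto (sampleTensor x m) atTop (𝓝 a₀)) (h1 : rawMoment 1 a₀ θ = 0)
    {w : ℕ → EuclideanSpace ℝ (Fin p)} {r : ℝ}
    (h : (fun n => ⟪t, w n - u₀⟫ - r * kurtosisScore (centralSecond (sampleTensor x m n))
        (centralFourth (sampleTensor x m n)) θ q) =o[atTop]
      (fun n => kurtosisScore (centralSecond (sampleTensor x m n))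
        (centralFourth (sampleTensor x m n)) θ)) :
    (fun n : ℕ => ⟪t, √n • (w n - u₀)⟫ - √n * (4 * r * (centralSecond a₀ θ *
      (mixedMoment x m θ q 3 n - centralThird a₀ θ * mixedMoment x m θ q 0 n) -
        centralFourth a₀ θ * mixedMoment x m θ q 1 n))) =o[atTop] (momentEnvelope x m δ θ q) := by
  -- Two errors: `e1` from expressing the maximizer through the score, `e2` from linearizing the
  -- score in the direction `q`.
  have e1 := ((isBigO_refl (fun n : ℕ => √n) atTop).mul_isLittleO h.norm_right).trans_isBigO
    (isBigO_sqrt_mul_norm_kurtosisScore (δ := δ) x m q ha h1)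
  have e2 := (((isBigO_refl (fun n : ℕ => √n) atTop).mul_isLittleO
    (isLittleO_kurtosisScore_sampleTensor x m θ q ha h1)).trans_isBigO
    (isBigO_momentEnvelope x m δ θ q none)).const_mul_left r
  refine (e1.add e2).congr_left fun n => ?_
  rw [real_inner_smul_right]
  ring

end Remainder

/-! ### The limiting covariance matrix. -/

section Covariance

variable {p : ℕ}

theorem orthProj_mulVec (θ t : EuclideanSpace ℝ (Fin p)) :
    orthProj θ *ᵥ t.ofLp = (t - ⟪‖θ‖⁻¹ • θ, t⟫ • (‖θ‖⁻¹ • θ)).ofLp := by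
  funext i
  simp only [real_inner_smul_left]
  simp only [orthProj, Matrix.sub_mulVec, Matrix.one_mulVec, Matrix.smul_mulVec,
    Matrix.vecMulVec_mulVec, PiLp.sub_apply, PiLp.smul_apply, Pi.sub_apply, Pi.smul_apply,
    smul_eq_mul, EuclideanSpace.inner_eq_star_dotProduct, star_trivial,
    MulOpposite.smul_eq_mul_unop, MulOpposite.unop_op]
  rw [dotProduct_comm]
  ring

theorem transpose_orthProj (θ : EuclideanSpace ℝ (Fin p)) : (orthProj θ)ᵀ = orthProj θ := by
  simp [orthProj, Matrix.transpose_vecMulVec]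

theorem kurtosisFactor_nonneg {β τ : ℝ} (hβ : 0 < β) (hβ4 : β ≤ 1 / 4) (hτ : 0 < τ) :
    0 ≤ kurtosisFactor β τ := by
  have h2 : 0 ≤ 1 - 2 * β := by linarith
  have h3 : 0 ≤ 1 - 3 * β := by linarith
  unfold kurtosisFactor
  positivity

theorem dotProduct_covKurtosis {α : ℝ} {μ₁ μ₂ : EuclideanSpace ℝ (Fin p)}
    {S : Matrix (Fin p) (Fin p) ℝ} (t : EuclideanSpace ℝ (Fin p)) :
    t.ofLp ⬝ᵥ covKurtosis α μ₁ μ₂ S *ᵥ t.ofLp =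
      kurtosisFactor (α * (1 - α)) (mahalanobisSq μ₁ μ₂ S) *
      ((1 + α * (1 - α) * mahalanobisSq μ₁ μ₂ S) /
        (‖discriminant μ₁ μ₂ S‖ ^ 2 * (α * (1 - α)))) *
      ((orthProj (discriminant μ₁ μ₂ S) *ᵥ t.ofLp) ⬝ᵥ
        S⁻¹ *ᵥ (orthProj (discriminant μ₁ μ₂ S) *ᵥ t.ofLp)) := by
  set R := orthProj (discriminant μ₁ μ₂ S) with hR
  have hRt : Rᵀ = R := transpose_orthProj _
  have h1 : t.ofLp ⬝ᵥ (R * S⁻¹ * R) *ᵥ t.ofLp = (R *ᵥ t.ofLp) ⬝ᵥ S⁻¹ *ᵥ (R *ᵥ t.ofLp) := by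
    rw [← Matrix.mulVec_mulVec, ← Matrix.mulVec_mulVec, Matrix.dotProduct_mulVec,
      ← Matrix.mulVec_transpose, hRt]
  rw [covKurtosis, covU, ← hR, Matrix.smul_mulVec, Matrix.smul_mulVec, dotProduct_smul,
    dotProduct_smul, h1, smul_eq_mul, smul_eq_mul]
  ring

theorem posSemidef_covKurtosis {α : ℝ} {μ₁ μ₂ : EuclideanSpace ℝ (Fin p)}
    {S : Matrix (Fin p) (Fin p) ℝ} (hS : S.PosDef) (hα0 : 0 < α) (hα1 : α < 1)
    (hτ : 0 < mahalanobisSq μ₁ μ₂ S) : (covKurtosis α μ₁ μ₂ S).PosSemidef := by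
  have h1 : 0 < 1 - α := sub_pos.2 hα1
  have hβ : 0 < α * (1 - α) := by positivity
  have hβ4 : α * (1 - α) ≤ 1 / 4 := by nlinarith [sq_nonneg (α - 1 / 2)]
  have hR := hS.inv.posSemidef.mul_mul_conjTranspose_same (orthProj (discriminant μ₁ μ₂ S))
  rw [Matrix.conjTranspose_eq_transpose_of_trivial, transpose_orthProj] at hR
  exact (hR.smul (by positivity)).smul (kurtosisFactor_nonneg hβ hβ4 hτ)

end Covariance

/-! ### The operator of `S`, sign symmetry and the excluded proportions. -/

section Main

variable {p : ℕ} {μ₁ μ₂ : EuclideanSpace ℝ (Fin p)} {S : Matrix (Fin p) (Fin p) ℝ}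

theorem toEuclideanCLM_inner_symm (hS : S.PosDef) (v w : EuclideanSpace ℝ (Fin p)) :
    ⟪toEuclideanCLM (𝕜 := ℝ) S v, w⟫ = ⟪v, toEuclideanCLM (𝕜 := ℝ) S w⟫ := by
  have hSt : Sᵀ = S := by
    rw [← Matrix.conjTranspose_eq_transpose_of_trivial]
    exact hS.isHermitian
  rw [real_inner_comm, Matrix.inner_toEuclideanCLM, Matrix.inner_toEuclideanCLM,
    Matrix.dotProduct_mulVec, ← Matrix.mulVec_transpose, hSt, dotProduct_comm]

theorem toEuclideanCLM_inner_pos (hS : S.PosDef) {v : EuclideanSpace ℝ (Fin p)} (hv : v ≠ 0) :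
    0 < ⟪toEuclideanCLM (𝕜 := ℝ) S v, v⟫ := by
  rw [real_inner_comm, Matrix.inner_toEuclideanCLM]
  have hv' : v.ofLp ≠ 0 := fun h => hv (by ext i; exact congrFun h i)
  simpa using hS.dotProduct_mulVec_pos hv'

theorem toEuclideanCLM_mul_inv_apply (hS : S.PosDef) (v : EuclideanSpace ℝ (Fin p)) :
    toEuclideanCLM (𝕜 := ℝ) S (toEuclideanCLM (𝕜 := ℝ) S⁻¹ v) = v := by
  rw [← mul_apply_eq_comp, ← map_mul,
    Matrix.mul_nonsing_inv _ ((Matrix.isUnit_iff_isUnit_det _).1 hS.isUnit), map_one]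
  rfl

theorem toEuclideanCLM_inv_mul_apply (hS : S.PosDef) (v : EuclideanSpace ℝ (Fin p)) :
    toEuclideanCLM (𝕜 := ℝ) S⁻¹ (toEuclideanCLM (𝕜 := ℝ) S v) = v := by
  rw [← mul_apply_eq_comp, ← map_mul,
    Matrix.nonsing_inv_mul _ ((Matrix.isUnit_iff_isUnit_det _).1 hS.isUnit), map_one]
  rfl

theorem toEuclideanCLM_discriminant (hS : S.PosDef) :
    toEuclideanCLM (𝕜 := ℝ) S (discriminant μ₁ μ₂ S) = μ₂ - μ₁ :=
  toEuclideanCLM_mul_inv_apply hS (μ₂ - μ₁)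

theorem inner_discriminant : ⟪μ₂ - μ₁, discriminant μ₁ μ₂ S⟫ = mahalanobisSq μ₁ μ₂ S :=
  Matrix.inner_toEuclideanCLM S⁻¹ (μ₂ - μ₁) (μ₂ - μ₁)

theorem IsKurtosisMaximizer.neg {x : ℕ → EuclideanSpace ℝ (Fin p)} {n : ℕ}
    {u : EuclideanSpace ℝ (Fin p)} (h : IsKurtosisMaximizer x n u) :
    IsKurtosisMaximizer x n (-u) := by
  refine ⟨by simpa using h.1, fun v hv => ?_⟩
  have : sampleKurtosis x n (-u) = sampleKurtosis x n u := by
    simp [sampleKurtosis, sampleMoment, Even.neg_pow (show Even 4 by decide)]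
  simpa only [Set.mem_ofPred_eq, this] using h.2 hv

/-- The quantity equals `6 ((α - 1/2)² - 1/12)`, so the two excluded proportions are exactly those
at which the population excess kurtosis vanishes in every direction. -/
theorem one_sub_six_mul_ne_zero {α : ℝ} (hδ₁ : α ≠ 1 / 2 - 1 / √12)
    (hδ₂ : α ≠ 1 / 2 + 1 / √12) : 1 - 6 * (α * (1 - α)) ≠ 0 := by
  intro h
  have h12 : (1 / √12 : ℝ) ^ 2 = 1 / 12 := by
    rw [div_pow, Real.sq_sqrt (by norm_num)]
    norm_num
  have : (α - 1 / 2 - 1 / √12) * (α - 1 / 2 + 1 / √12) = 0 := by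
    linear_combination (1 / 6) * h - h12
  rcases mul_eq_zero.1 this with h | h
  · exact hδ₂ (by linarith)
  · exact hδ₁ (by linarith)

end Main

end LinDisc

theorem theorem2 {Ω : Type*} [MeasurableSpace Ω] (P : Measure Ω) [IsProbabilityMeasure P]
    {p : ℕ} (α : ℝ) (hα0 : 0 < α) (hα1 : α < 1)
    (hδ₁ : α ≠ 1 / 2 - 1 / Real.sqrt 12) (hδ₂ : α ≠ 1 / 2 + 1 / Real.sqrt 12)
    (μ₁ μ₂ : EuclideanSpace ℝ (Fin p)) (hμ : μ₁ ≠ μ₂)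
    (S : Matrix (Fin p) (Fin p) ℝ) (hS : S.PosDef)
    (x : ℕ → Ω → EuclideanSpace ℝ (Fin p))
    (hindep : iIndepFun x P)
    (hlaw : ∀ i, HasLaw (x i) (mixtureLaw ⟨α, hα0.le, hα1.le⟩ μ₁ μ₂ S) P)
    (u : ℕ → Ω → EuclideanSpace ℝ (Fin p)) (hu : ∀ n, AEMeasurable (u n) P)
    (hmax : ∀ᵐ ω ∂P, ∀ᶠ n in atTop, IsKurtosisMaximizer (fun i => x i ω) n (u n ω)) :
    (covKurtosis α μ₁ μ₂ S).PosSemidef ∧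
    ∃ s : ℕ → Ω → ℝ, (∀ n, Measurable (s n)) ∧ (∀ n ω, s n ω = 1 ∨ s n ω = -1) ∧
      (∀ᵐ ω ∂P, Tendsto (fun n => s n ω • u n ω) atTop (𝓝 (unitDiscriminant μ₁ μ₂ S))) ∧
      TendstoInDistribution
        (fun (n : ℕ) (ω : Ω) =>
          Real.sqrt (n : ℝ) • (s n ω • u n ω - unitDiscriminant μ₁ μ₂ S))
        atTop (id : EuclideanSpace ℝ (Fin p) → EuclideanSpace ℝ (Fin p)) (fun _ => P)
        (multivariateGaussian 0 (covKurtosis α μ₁ μ₂ S)) := by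
  set a : unitInterval := ⟨α, hα0.le, hα1.le⟩ with ha
  set β := α * (1 - α) with hβ
  have hβa : (a : ℝ) * (1 - a) = β := rfl
  have hβ0 : 0 < β := mul_pos hα0 (sub_pos.2 hα1)
  have h6 : 1 - 6 * β ≠ 0 := one_sub_six_mul_ne_zero hδ₁ hδ₂
  set δ := μ₂ - μ₁ with hδ
  have hδ0 : δ ≠ 0 := sub_ne_zero.2 hμ.symm
  set T := toEuclideanCLM (𝕜 := ℝ) S with hT
  set B := toEuclideanCLM (𝕜 := ℝ) S⁻¹ with hB
  set θ := discriminant μ₁ μ₂ S with hθ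
  set τ := mahalanobisSq μ₁ μ₂ S with hτ
  have hTθ : T θ = δ := toEuclideanCLM_discriminant hS
  have hθ0 : θ ≠ 0 := fun h => hδ0 (by rw [← hTθ, h, map_zero])
  have hTθθ : inner ℝ (T θ) θ = τ := by rw [hTθ]; exact inner_discriminant
  have hδθ : inner ℝ δ θ = τ := inner_discriminant
  have hτ0 : 0 < τ := hTθθ ▸ toEuclideanCLM_inner_pos hS hθ0
  have hθn : 0 < ‖θ‖ := norm_pos_iff.2 hθ0
  have hquad : ∀ v w : EuclideanSpace ℝ (Fin p), v.ofLp ⬝ᵥ S *ᵥ w.ofLp = inner ℝ (T v) w :=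
    fun v w => by rw [toEuclideanCLM_inner_symm hS, Matrix.inner_toEuclideanCLM]
  have hc : β * (1 - 6 * β) ≠ 0 := mul_ne_zero hβ0.ne' h6
  set m := mixtureMean a μ₁ μ₂ with hm
  set a₀ := mixtureTensor a μ₁ μ₂ S with ha₀
  have hpop := centralMoments_mixtureTensor (μ₁ := μ₁) (μ₂ := μ₂) hS.posSemidef hβa
  have hM₂ : ∀ v, centralSecond a₀ v = inner ℝ (T v) v + β * inner ℝ (T θ) v ^ 2 := fun v => by
    rw [(hpop v).2.1, hquad, hTθ, real_inner_comm δ v]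
  have hM₄ : ∀ v, centralFourth a₀ v =
      3 * centralSecond a₀ v ^ 2 + β * (1 - 6 * β) * inner ℝ (T θ) v ^ 4 := fun v => by
    rw [(hpop v).2.2.2, hTθ, real_inner_comm δ v]
  -- The sign moves the maximizer into the half space of `θ`. It is read off the measurable version
  -- of `u n`, since `u n` itself is only almost everywhere measurable.
  set s : ℕ → Ω → ℝ := fun n ω => if 0 ≤ inner ℝ ((hu n).mk _ ω) θ then 1 else -1 with hs
  have hsm : ∀ n, Measurable (s n) := fun n =>
    Measurable.ite (measurableSet_le measurable_const
      ((hu n).measurable_mk.inner measurable_const)) measurable_const measurable_const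
  have hs1 : ∀ n ω, s n ω = 1 ∨ s n ω = -1 := fun n ω => by
    simp only [hs]
    split_ifs <;> simp
  have hmk : ∀ᵐ ω ∂P, ∀ n, u n ω = (hu n).mk _ ω := ae_all_iff.2 fun n => (hu n).ae_eq_mk
  have hkey : ∀ᵐ ω ∂P, Tendsto (sampleTensor (fun i => x i ω) m) atTop (𝓝 a₀) ∧
      Tendsto (fun n => s n ω • u n ω) atTop (𝓝 (‖θ‖⁻¹ • θ)) ∧
      ∀ t : EuclideanSpace ℝ (Fin p),
      (fun n => inner ℝ t (s n ω • u n ω - ‖θ‖⁻¹ • θ) -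
        (4 * (β * (1 - 6 * β)) * inner ℝ (T θ) θ ^ 4 * ‖θ‖)⁻¹ *
        kurtosisScore (centralSecond (sampleTensor (fun i => x i ω) m n))
          (centralFourth (sampleTensor (fun i => x i ω) m n)) θ
          (B (t - inner ℝ (‖θ‖⁻¹ • θ) t • (‖θ‖⁻¹ • θ))))
      =o[atTop] (fun n => kurtosisScore (centralSecond (sampleTensor (fun i => x i ω) m n))
          (centralFourth (sampleTensor (fun i => x i ω) m n)) θ) := by
    filter_upwards [ae_tendsto_sampleTensor hindep hlaw, hmk, hmax] with ω hω hmkω hmaxω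
    refine ⟨hω, ?_⟩
    refine isLittleO_maximizer_sub contDiff_centralSecond contDiff_centralFourth
      centralSecond_smul centralFourth_smul (toEuclideanCLM_inner_symm hS)
      (fun v hv => toEuclideanCLM_inner_pos hS hv) (toEuclideanCLM_inv_mul_apply hS)
      (toEuclideanCLM_mul_inv_apply hS) hθ0 hβ0.le hc hM₂ hM₄ hω (fun n => ?_) ?_
    · simp only [hs, real_inner_smul_left, hmkω n]
      split_ifs with h
      · simpa using h
      · push Not at h
        linarith
    · filter_upwards [hmaxω, eventually_ne_atTop 0] with n hn hn0
      have : IsKurtosisMaximizer (fun i => x i ω) n (s n ω • u n ω) := by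
        rcases hs1 n ω with h | h
        · simpa [h] using hn
        · simpa [h] using hn.neg
      rw [excessSq_sampleTensor _ m hn0]
      exact this
  have hw : ∀ n, AEMeasurable (fun ω => s n ω • u n ω) P := fun n =>
    (hsm n).aemeasurable.smul (hu n)
  refine ⟨posSemidef_covKurtosis hS hα0 hα1 hτ0, s, hsm, hs1, hkey.mono fun ω h => h.2.1, ?_⟩
  have hX : ∀ n : ℕ, AEMeasurable
      (fun ω => √n • (s n ω • u n ω - unitDiscriminant μ₁ μ₂ S)) P := fun n => by
    have := hw n
    fun_prop
  refine tendstoInDistribution_multivariateGaussian_of_inner hX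
    (posSemidef_covKurtosis hS hα0 hα1 hτ0) fun t => ?_
  set Rt := t - inner ℝ (‖θ‖⁻¹ • θ) t • (‖θ‖⁻¹ • θ) with hRt
  set q := B Rt with hq
  have hTq : T q = Rt := toEuclideanCLM_mul_inv_apply hS Rt
  -- Since `T θ = δ` and `T q = Rt`, this is the orthogonality of `θ` and the projected vector `Rt`.
  have hδq : inner ℝ δ q = 0 := by
    rw [← hTθ, toEuclideanCLM_inner_symm hS, hTq, hRt, inner_sub_right, real_inner_smul_right,
      real_inner_smul_right, real_inner_smul_left, real_inner_self_eq_norm_sq]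
    field_simp
    ring
  set r := (4 * (β * (1 - 6 * β)) * inner ℝ (T θ) θ ^ 4 * ‖θ‖)⁻¹ with hr
  have hlead := tendstoInDistribution_leading_term hS.posSemidef hindep hlaw
    (v := θ) (q := q) (by rw [hquad, hTθ, hδq]) (by rw [real_inner_comm, hδq]) hβa
    (by rw [hquad, hTθθ]) (by rw [real_inner_comm, hδθ]) (4 * r)
  -- Here `(4r)² = 1 / (β² (1 - 6β)² τ⁸ ‖θ‖²)`, which against `τ⁵` leaves the denominators of `C_κ`
  -- and of the prefactor of `Ψ_U`.
  have hvar : (4 * r) ^ 2 * (τ ^ 5 * (1 + β * τ) *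
        (6 + 24 * β * τ + 9 * β * (1 - 2 * β) * τ ^ 2 + β * (1 - 3 * β) * τ ^ 3)) *
        (q.ofLp ⬝ᵥ S *ᵥ q.ofLp) = t.ofLp ⬝ᵥ covKurtosis α μ₁ μ₂ S *ᵥ t.ofLp := by
    have e1 : q.ofLp ⬝ᵥ S *ᵥ q.ofLp = Rt.ofLp ⬝ᵥ S⁻¹ *ᵥ Rt.ofLp := by
      rw [hquad, hTq, ← Matrix.inner_toEuclideanCLM]
    rw [dotProduct_covKurtosis, orthProj_mulVec, e1, hr, hTθθ, kurtosisFactor, ← hβ, ← hτ, ← hθ,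
      ← hRt]
    field_simp
  rw [hvar] at hlead
  -- Slutsky: only the difference from the leading term remains to be shown negligible in
  -- probability.
  refine tendstoInDistribution_of_tendstoInMeasure_sub _ _ hlead ?_
    fun n => (aemeasurable_const (b := t)).inner (hX n)
  have henv : ∀ o k, (∀ n : ℕ, Integrable (fun ω => (√n * mixedMoment (fun i => x i ω) m θ
      (orthDirection δ θ q o) k n) ^ 2) P) ∧ ∃ C, ∀ n : ℕ, ∫ ω, (√n * mixedMoment
      (fun i => x i ω) m θ (orthDirection δ θ q o) k n) ^ 2 ∂P ≤ C := fun o k => by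
    have ho := inner_orthDirection (hδθ.trans_ne hτ0.ne') hδq o
    exact exists_integral_mixedMoment_sq_le hS.posSemidef hindep hlaw
      (by rw [hquad, hTθ, ho]) (by rw [real_inner_comm, ho]) k
  choose hint C hC using henv
  refine tendstoInMeasure_of_ae_isLittleO
    (Y := fun n ω => momentEnvelope (fun i => x i ω) m δ θ q n)
    (C := 1 + ∑ o, ∑ k ∈ Finset.range 4, C o k) (fun n => ?_) (fun n => ?_) (fun n ω => ?_)
    (fun n => ?_) ?_
  · exact ((aemeasurable_const (b := t)).inner (hX n)).sub
      (hlead.forall_aemeasurable n)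
  · exact (integrable_const _).add (integrable_finsetSum _ fun o _ =>
      integrable_finsetSum _ fun k _ => hint o k n)
  · exact le_add_of_nonneg_right
      (Finset.sum_nonneg fun o _ => Finset.sum_nonneg fun k _ => sq_nonneg _)
  · unfold momentEnvelope
    rw [integral_add (integrable_const _) (integrable_finsetSum _ fun o _ =>
      integrable_finsetSum _ fun k _ => hint o k n), integral_finsetSum _ fun o _ =>
      integrable_finsetSum _ fun k _ => hint o k n]
    simp only [integral_const, probReal_univ, one_smul]
    gcongr with o _
    rw [integral_finsetSum _ fun k _ => hint o k n]
    exact Finset.sum_le_sum fun k _ => hC o k n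
  · filter_upwards [hkey] with ω hω
    exact isLittleO_remainder (fun i => x i ω) m hω.1 (hpop θ).1 (hω.2.2 t)
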